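/- Let $\Delta$ be a building of type $\widetilde A_2$ and order $q\ge 2$ (each edge lies on exactly $q+1$ chambers), with vertices labelled by types in $\mathbb Z/3$, and let $\Gamma$ be a group of type preserving automorphisms of $\Delta$ which acts regularly (freely and transitively) on the chambers of $\Delta$. Identify the vertices of an apartment with the triangular lattice $\mathbb Z^2$, the two basis vectors forming an angle $\pi/3$, so that the vertex type increases by $1$ along the first basis vector and decreases by $1$ along the second. A *parametrized parallelogram of shape* $(m,n)$ is the convex hull $[0,m]\times[0,n]$ of $(0,0)$ and $(m,n)$ in such an apartment, with its vertices $v_{ij}$, $0\le i\le m$, $0\le j\le n$. A *tile* is a parametrized parallelogram of shape $(2,2)$. Let $A$ be the set of $\Gamma$-orbits of tiles. Define $\{0,1\}$-matrices $M_1,M_2$ indexed by $A$ as follows: $M_1(b,a)=1$ [resp. $M_2(b,a)=1$] if and only if $a=\Gamma\tau_1$, $b=\Gamma\tau_2$ for tiles $\tau_1,\tau_2$ whose union is a parallelogram $\pi$ of shape $(3,2)$ [resp. $(2,3)$], with $v_{ij}(\tau_1)=v_{ij}(\pi)$ and $v_{ij}(\tau_2)=v_{i+1,j}(\pi)$ [resp.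 $v_{i,j+1}(\pi)$]. A *word* of shape $(m,n)$ is a map $w:\{0,\dots,m\}\times\{0,\dots,n\}\to A$ with $M_1(w_{i+1,j},w_{i,j})=1$ and $M_2(w_{i,j+1},w_{i,j})=1$ whenever these are defined; $W_{m,n}$ is the set of these words, and $o(w)=w_{0,0}$, $t(w)=w_{m,n}$. For $p\in\mathbb Z^2$, the word $w$ is *$p$-periodic* if $w_{l+p}=w_l$ whenever both $l$ and $l+p$ lie in its domain. Then $A$ is finite, $M_1$ and $M_2$ are nonzero, and the following conditions hold. (H1) If $u\in W_{m,n}$, $v\in W_{r,s}$ and $t(u)=o(v)$, then there is a unique $w\in W_{m+r,n+s}$ with $w_{i,j}=u_{i,j}$ for $0\le i\le m$, $0\le j\le n$, and $w_{m+i,n+j}=v_{i,j}$ for $0\le i\le r$, $0\le j\le s$. (H2) The directed graph with vertex set $A$ and a directed edge from $a$ to $b$ for each $i\in\{1,2\}$ with $M_i(b,a)=1$ is irreducible: for all $a,b\in A$ there is a directed path of positive length from $a$ to $b$. Indeed, for all $a,b\in A$ there is a directed path of length $4$ from $a$ to $b$. (H3) For each $p\in\mathbb Z^2\setminus\{(0,0)\}$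 there is a word which is not $p$-periodic. -/

import Mathlib

/-! ### The Coxeter complex of type `Ã₂`

The plane tessellated by equilateral triangles.  The vertices are the points of the lattice
`ℤ × ℤ` in the basis of two unit vectors at an angle of `π/3`; the chambers are the triangles
`{(i,j), (i+1,j), (i,j+1)}` and `{(i+1,j), (i,j+1), (i+1,j+1)}`; the simplices are
the nonempty subsets of the chambers. -/

/-- The triangle with vertices `(i,j), (i+1,j), (i,j+1)`. -/
def upTriangle (i j : ℤ) : Finset (ℤ × ℤ) := {(i, j), (i + 1, j), (i, j + 1)}

/-- The triangle with vertices `(i+1,j), (i,j+1), (i+1,j+1)`. -/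
def downTriangle (i j : ℤ) : Finset (ℤ × ℤ) := {(i + 1, j), (i, j + 1), (i + 1, j + 1)}

/-- The Coxeter complex of type `Ã₂`. -/
def coxeterPlane : AbstractSimplicialComplex (ℤ × ℤ) where
  faces := {s | s.Nonempty ∧ ∃ i j : ℤ, s ⊆ upTriangle i j ∨ s ⊆ downTriangle i j}
  isRelLowerSet_faces := by
    rintro s ⟨hs, i, j, h⟩
    exact ⟨hs, fun t hts ht => ⟨ht, i, j, h.imp hts.trans hts.trans⟩⟩
  singleton_mem := by
    rintro ⟨i, j⟩
    exact ⟨Finset.singleton_nonempty _, i, j, Or.inl (by simp [upTriangle])⟩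

/-- `φ` is an isomorphism from the Coxeter complex of type `Ã₂` onto the complex `S`. -/
def IsChart {V : Type*} (S : PreAbstractSimplicialComplex V) (φ : ℤ × ℤ ↪ V) : Prop :=
  S.faces = Finset.map φ '' coxeterPlane.faces

/-! ### Buildings of type `Ã₂` -/

/-- A building of type `Ã₂` with vertex set `V`, together with a labelling of its vertices by types
in `ℤ/3` and a system of apartments. -/
structure TriangleBuilding (V : Type*) where
  /-- the underlying simplicial complex -/
  complex : AbstractSimplicialComplex V
  /-- the type of a vertex -/
  type : V → ZMod 3
  /-- the apartments, which are subcomplexes -/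
  apartments : Set (PreAbstractSimplicialComplex V)
  nonempty : Nonempty V
  /-- the vertices of a simplex have distinct types (so a chamber has one vertex of each type) -/
  type_injOn : ∀ s ∈ complex, Set.InjOn type (s : Set V)
  apartment_le : ∀ S ∈ apartments, S ≤ complex.toPreAbstractSimplicialComplex
  /-- apartments are Coxeter complexes of type `Ã₂` -/
  exists_chart : ∀ S ∈ apartments, ∃ φ : ℤ × ℤ ↪ V, IsChart S φ
  /-- any two simplices lie in a common apartment -/
  exists_apartment : ∀ s ∈ complex, ∀ t ∈ complex, ∃ S ∈ apartments, s ∈ S ∧ t ∈ S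
  /-- if two apartments `S`, `S'` both contain the simplices `s` and `t`, then there is an
  isomorphism from `S` to `S'` (namely `φ' ∘ φ⁻¹`) which fixes `s` and `t` pointwise -/
  exists_iso : ∀ S ∈ apartments, ∀ S' ∈ apartments, ∀ s t : Finset V,
    s ∈ S → s ∈ S' → t ∈ S → t ∈ S' →
      ∃ φ φ' : ℤ × ℤ ↪ V, IsChart S φ ∧ IsChart S' φ' ∧
        ∀ x, φ x ∈ s ∨ φ x ∈ t → φ' x = φ x

namespace TriangleBuilding

variable {V : Type*} (B : TriangleBuilding V)

/-- The chambers: the simplices with three vertices. -/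
def chambers : Set (Finset V) := {c | c ∈ B.complex ∧ c.card = 3}

/-- The building has order `q`: each edge lies on exactly `q + 1` chambers. -/
def HasOrder (q : ℕ) : Prop :=
  ∀ e ∈ B.complex, e.card = 2 → {c | c ∈ B.chambers ∧ e ⊆ c}.ncard = q + 1

/-- The group of type preserving automorphisms of the building. -/
def typePreservingAut : Subgroup (Equiv.Perm V) where
  carrier := {g | (∀ s : Finset V, s.map g.toEmbedding ∈ B.complex ↔ s ∈ B.complex) ∧
    ∀ v, B.type (g v) = B.type v}
  one_mem' := by
    refine ⟨fun s => ?_, fun v => rfl⟩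
    have : s.map (1 : Equiv.Perm V).toEmbedding = s := Finset.map_refl
    rw [this]
  mul_mem' := by
    rintro g h ⟨hg, hg'⟩ ⟨hh, hh'⟩
    refine ⟨fun s => ?_, fun v => (hg' (h v)).trans (hh' v)⟩
    have : s.map (g * h).toEmbedding = (s.map h.toEmbedding).map g.toEmbedding := by
      rw [Finset.map_map]; rfl
    rw [this, hg, hh]
  inv_mem' := by
    rintro g ⟨hg, hg'⟩
    refine ⟨fun s => ?_, fun v => ?_⟩
    · have : (s.map (g⁻¹).toEmbedding).map g.toEmbedding = s := by
        rw [Finset.map_map]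
        have h : (g⁻¹).toEmbedding.trans g.toEmbedding = Function.Embedding.refl V := by
          ext x; exact g.apply_symm_apply x
        rw [h, Finset.map_refl]
      rw [← hg, this]
    · rw [← hg' (g⁻¹ v)]; simp

/-- The group `Γ` acts regularly, that is, freely and transitively, on the chambers. -/
def ActsRegularlyOnChambers (Γ : Subgroup (Equiv.Perm V)) : Prop :=
  ∀ c ∈ B.chambers, ∀ d ∈ B.chambers, ∃! γ : Equiv.Perm V, γ ∈ Γ ∧ c.map γ.toEmbedding = d

/-- `φ` is an isomorphism of the Coxeter complex onto an apartment such that types increase by one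
along the first basis vector of the lattice and decrease by one along the second. -/
def IsOrientedChart (φ : ℤ × ℤ ↪ V) : Prop :=
  (∃ S ∈ B.apartments, IsChart S φ) ∧
    ∀ i j : ℤ, B.type (φ (i, j)) = B.type (φ (0, 0)) + (i : ZMod 3) - (j : ZMod 3)

/-- A parametrized parallelogram of shape `(m, n)`: the convex hull of two vertices `u`, `v` such
that the ordered pair `(u, v)` has shape `(m, n)`, that is, `u = φ (0, 0)` and `v = φ (m, n)` for
an oriented chart `φ` of an apartment.  In this chart the convex hull (the intersection of the
half-planes bounded by walls which contain `u` and `v`) is `[0, m] × [0, n]`.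
The vertex `v_{ij}` is `φ (i, j)`. -/
structure Parallelogram (m n : ℕ) where
  /-- the vertices `v_{ij}` with `0 ≤ i ≤ m` and `0 ≤ j ≤ n` -/
  vertex : Fin (m + 1) → Fin (n + 1) → V
  exists_chart : ∃ φ : ℤ × ℤ ↪ V, B.IsOrientedChart φ ∧ ∀ i j, vertex i j = φ ((i : ℤ), (j : ℤ))

/-- A tile is a parallelogram of shape `(2, 2)`. -/
abbrev Tile := B.Parallelogram 2 2

/-- Two tiles are equivalent if some element of `Γ` maps the first to the second. -/
def tileSetoid (Γ : Subgroup (Equiv.Perm V)) : Setoid B.Tile where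
  r τ τ' := ∃ γ ∈ Γ, ∀ i j, γ (τ.vertex i j) = τ'.vertex i j
  iseqv :=
    { refl := fun _ => ⟨1, Γ.one_mem, fun _ _ => rfl⟩
      symm := by
        rintro τ τ' ⟨γ, hγ, h⟩
        exact ⟨γ⁻¹, Γ.inv_mem hγ, fun i j => by rw [← h]; simp⟩
      trans := by
        rintro τ τ' τ'' ⟨γ, hγ, h⟩ ⟨γ', hγ', h'⟩
        exact ⟨γ' * γ, Γ.mul_mem hγ' hγ, fun i j => by rw [← h', ← h]; rfl⟩ }

/-- The alphabet: the set of `Γ`-orbits of tiles. -/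
def Alphabet (Γ : Subgroup (Equiv.Perm V)) : Type _ := Quotient (B.tileSetoid Γ)

/-- The `Γ`-orbit of a tile. -/
def orbit (Γ : Subgroup (Equiv.Perm V)) (τ : B.Tile) : B.Alphabet Γ :=
  Quotient.mk (B.tileSetoid Γ) τ

/-- `M₁(b, a) = 1` if and only if `a = Γτ₁` and `b = Γτ₂`, where `τ₁ ∪ τ₂` is a parallelogram `π` of
shape `(3, 2)` with initial tile `τ₁` and terminal tile `τ₂`; otherwise `M₁(b, a) = 0`. -/
noncomputable def M₁ (Γ : Subgroup (Equiv.Perm V)) :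
    Matrix (B.Alphabet Γ) (B.Alphabet Γ) ℤ :=
  open Classical in
  Matrix.of fun b a =>
    if ∃ (τ₁ τ₂ : B.Tile) (π : B.Parallelogram 3 2),
        a = B.orbit Γ τ₁ ∧ b = B.orbit Γ τ₂ ∧
          ∀ i j, τ₁.vertex i j = π.vertex i.castSucc j ∧ τ₂.vertex i j = π.vertex i.succ j
    then 1 else 0

/-- `M₂(b, a) = 1` if and only if `a = Γτ₁` and `b = Γτ₂`, where `τ₁ ∪ τ₂` is a parallelogram `π` of
shape `(2, 3)` with initial tile `τ₁` and terminal tile `τ₂`; otherwise `M₂(b, a) = 0`. -/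
noncomputable def M₂ (Γ : Subgroup (Equiv.Perm V)) :
    Matrix (B.Alphabet Γ) (B.Alphabet Γ) ℤ :=
  open Classical in
  Matrix.of fun b a =>
    if ∃ (τ₁ τ₂ : B.Tile) (π : B.Parallelogram 2 3),
        a = B.orbit Γ τ₁ ∧ b = B.orbit Γ τ₂ ∧
          ∀ i j, τ₁.vertex i j = π.vertex i j.castSucc ∧ τ₂.vertex i j = π.vertex i j.succ
    then 1 else 0

end TriangleBuilding

/-! ### Two-dimensional words and the conditions (H1), (H2), (H3) -/

namespace RankTwo

variable {A : Type*} (M₁ M₂ : Matrix A A ℤ)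

/-- A word of shape `(m, n)` in the alphabet `A`. -/
structure Word (m n : ℕ) where
  /-- the letters `w_{i,j}` with `0 ≤ i ≤ m` and `0 ≤ j ≤ n` -/
  letter : Fin (m + 1) → Fin (n + 1) → A
  step₁ : ∀ (i : Fin m) (j : Fin (n + 1)), M₁ (letter i.succ j) (letter i.castSucc j) = 1
  step₂ : ∀ (i : Fin (m + 1)) (j : Fin n), M₂ (letter i j.succ) (letter i j.castSucc) = 1

variable {M₁ M₂}

/-- The initial letter `o(w) = w_{0,0}`. -/
def Word.o {m n : ℕ} (w : Word M₁ M₂ m n) : A := w.letter 0 0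

/-- The final letter `t(w) = w_{m,n}`. -/
def Word.t {m n : ℕ} (w : Word M₁ M₂ m n) : A := w.letter (Fin.last m) (Fin.last n)

/-- `w` is the product `uv`: it restricts to `u` on `[0, m] × [0, n]` and to the translate of `v` on
`[m, m + r] × [n, n + s]`. -/
def Word.IsProduct {m n r s : ℕ} (u : Word M₁ M₂ m n) (v : Word M₁ M₂ r s)
    (w : Word M₁ M₂ (m + r) (n + s)) : Prop :=
  (∀ (i : Fin (m + 1)) (j : Fin (n + 1)),
    w.letter ⟨i, by omega⟩ ⟨j, by omega⟩ = u.letter i j) ∧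
  (∀ (i : Fin (r + 1)) (j : Fin (s + 1)),
    w.letter ⟨m + i, by omega⟩ ⟨n + j, by omega⟩ = v.letter i j)

/-- `w` is `(p₁, p₂)`-periodic: it agrees with its translate by `(p₁, p₂)` wherever both are
defined. -/
def Word.IsPeriodic {m n : ℕ} (w : Word M₁ M₂ m n) (p : ℤ × ℤ) : Prop :=
  ∀ (i i' : Fin (m + 1)) (j j' : Fin (n + 1)),
    (i' : ℤ) = (i : ℤ) + p.1 → (j' : ℤ) = (j : ℤ) + p.2 → w.letter i' j' = w.letter i j

variable (M₁ M₂)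

/-- (H1): unique products of words. -/
def H1 : Prop :=
  ∀ (m n r s : ℕ) (u : Word M₁ M₂ m n) (v : Word M₁ M₂ r s), u.t = v.o →
    ∃! w : Word M₁ M₂ (m + r) (n + s), u.IsProduct v w

/-- There is a directed edge from `a` to `b`. -/
def Edge (a b : A) : Prop := M₁ b a = 1 ∨ M₂ b a = 1

/-- There is a directed path of length `k` from `a` to `b`. -/
def HasPath (k : ℕ) (a b : A) : Prop :=
  ∃ x : Fin (k + 1) → A, x 0 = a ∧ x (Fin.last k) = b ∧
    ∀ i : Fin k, Edge M₁ M₂ (x i.castSucc) (x i.succ)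

/-- (H2): the directed graph is irreducible, that is, there is a directed path of positive length
from any vertex to any vertex. -/
def H2 : Prop := ∀ a b : A, ∃ k : ℕ, 0 < k ∧ HasPath M₁ M₂ k a b

/-- (H3): for each nonzero `p`, some word is not `p`-periodic. -/
def H3 : Prop :=
  ∀ p : ℤ × ℤ, p ≠ 0 → ∃ (m n : ℕ) (w : Word M₁ M₂ m n), ¬ w.IsPeriodic p

end RankTwo

/-! ### Frames and symmetries of the plane -/

/-! The proof works with flats: injective simplicial maps of the plane into the building with the
prescribed orientation of types. Two geometric facts carry it.

Convexity (`convex_base`, `convex_frame`): if a chart of an apartment and a flat agree on an edge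
and at a point off its line, they agree at the third vertex of the chamber on that side. The
retraction onto the apartment centred at that chamber preserves adjacency and types. Were the flat
to leave the apartment across the edge, the retraction would fold it, and the folded vertex would
lie too far from the retained point.

Extension (`exists_extension_frame`): a chamber glued to an apartment along an edge, on the side
away from the origin, lies in an apartment with the base chamber. Convexity shows that the new chart
keeps what lies between. Consequently rectangles grow row by row and column by column, and every
rectangle of a flat lies in an apartment (`IsFlat.exists_chart`), so a flat has a letter at each
lattice point and these letters form words.

Regularity of the action enters in two ways. Freeness makes a tile recoverable from its letter and
one of its chambers (`agreeOn_of_letter_eq`); transitivity with preservation of types moves a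
chamber of one flat onto a chamber of another, vertex by vertex (`exists_move_triangle`).

(H1) is combinatorial once two consecutive steps in different directions complete to a unique square
of letters (`existsUnique_square₁`, `existsUnique_square₂`). For (H2), a tile with letter `b` is
glued onto a chart which begins with `a`, at distance `(2,2)`, `(3,1)` or `(1,3)` according to
types. For (H3), thickness gives two charts which agree on a large region and part at one vertex; if
all words were periodic, a common letter would be carried to a place where the charts differ.
Finiteness holds because every orbit of tiles has a member built on one fixed chamber, and the
building is locally finite. -/

/-- Two distinct points of the lattice are adjacent if they span an edge of the Coxeter complex. -/
def PlaneAdj (p q : ℤ × ℤ) : Prop :=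
  (q.1 = p.1 + 1 ∧ q.2 = p.2) ∨ (q.1 = p.1 ∧ q.2 = p.2 + 1) ∨ (q.1 = p.1 - 1 ∧ q.2 = p.2 + 1) ∨
  (q.1 = p.1 - 1 ∧ q.2 = p.2) ∨ (q.1 = p.1 ∧ q.2 = p.2 - 1) ∨ (q.1 = p.1 + 1 ∧ q.2 = p.2 - 1)

/-- The pair `(u, w)` of vectors is a frame if `x, x + u, x + w` are the vertices of a chamber, of
types `t, t + 1, t - 1`. -/
def IsFrame (u w : ℤ × ℤ) : Prop :=
  (u = (1, 0) ∨ u = (0, -1) ∨ u = (-1, 1)) ∧ (w = (-1, 0) ∨ w = (0, 1) ∨ w = (1, -1)) ∧ w ≠ -u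

theorem IsFrame.cases {u w : ℤ × ℤ} (h : IsFrame u w) :
    (u = (1, 0) ∧ w = (0, 1)) ∨ (u = (1, 0) ∧ w = (1, -1)) ∨ (u = (0, -1) ∧ w = (-1, 0)) ∨
    (u = (0, -1) ∧ w = (1, -1)) ∨ (u = (-1, 1) ∧ w = (-1, 0)) ∨ (u = (-1, 1) ∧ w = (0, 1)) := by
  obtain ⟨rfl | rfl | rfl, rfl | rfl | rfl, h⟩ := h <;> simp_all

theorem isFrame_std : IsFrame (1, 0) (0, 1) := by simp [IsFrame]

theorem singleton_mem_plane (p : ℤ × ℤ) : {p} ∈ coxeterPlane.faces :=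
  coxeterPlane.singleton_mem p

theorem pair_mem_plane {p q : ℤ × ℤ} (h : PlaneAdj p q) : {p, q} ∈ coxeterPlane.faces := by
  obtain ⟨p1, p2⟩ := p
  obtain ⟨q1, q2⟩ := q
  refine ⟨by simp, min p1 q1, min p2 q2, ?_⟩
  simp only [PlaneAdj] at h
  simp only [upTriangle, downTriangle, Finset.insert_subset_iff, Finset.singleton_subset_iff,
    Finset.mem_insert, Finset.mem_singleton, Prod.mk.injEq]
  omega

theorem planeAdj_of_pair_mem {p q : ℤ × ℤ} (h : {p, q} ∈ coxeterPlane.faces) (hne : p ≠ q) :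
    PlaneAdj p q := by
  obtain ⟨p1, p2⟩ := p
  obtain ⟨q1, q2⟩ := q
  obtain ⟨-, i, j, h⟩ := h
  simp only [upTriangle, downTriangle, Finset.insert_subset_iff, Finset.singleton_subset_iff,
    Finset.mem_insert, Finset.mem_singleton, Prod.mk.injEq] at h
  simp only [ne_eq, Prod.mk.injEq] at hne
  simp only [PlaneAdj]
  omega

theorem PlaneAdj.ne {p q : ℤ × ℤ} (h : PlaneAdj p q) : p ≠ q := by
  rintro rfl
  simp only [PlaneAdj] at h
  omega

theorem PlaneAdj.symm {p q : ℤ × ℤ} (h : PlaneAdj p q) : PlaneAdj q p := by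
  simp only [PlaneAdj] at *
  omega

theorem mem_plane_of_subset {s t : Finset (ℤ × ℤ)} (hs : s ∈ coxeterPlane.faces) (h : t ⊆ s)
    (ht : t.Nonempty) : t ∈ coxeterPlane.faces :=
  (coxeterPlane.isRelLowerSet_faces hs).2 h ht

theorem planeAdj_of_mem {s : Finset (ℤ × ℤ)} (hs : s ∈ coxeterPlane.faces) {p q : ℤ × ℤ}
    (hp : p ∈ s) (hq : q ∈ s) (hne : p ≠ q) : PlaneAdj p q :=
  planeAdj_of_pair_mem (mem_plane_of_subset hs (by simp [Finset.insert_subset_iff, *]) (by simp))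
    hne

/-- An edge of the plane lies on at most two chambers. -/
theorem apex_cases {y z p : ℤ × ℤ} (hyz : PlaneAdj y z) (hyp : PlaneAdj y p)
    (hzp : PlaneAdj z p) :
    (p.1 = y.1 - (z.2 - y.2) ∧ p.2 = y.2 + (z.1 - y.1) + (z.2 - y.2)) ∨
    (p.1 = y.1 + (z.1 - y.1) + (z.2 - y.2) ∧ p.2 = y.2 - (z.1 - y.1)) := by
  unfold PlaneAdj at hyz hyp hzp
  rcases hyz with h | h | h | h | h | h <;> rcases hyp with h' | h' | h' | h' | h' | h' <;> omega

theorem apex_unique {y z p q r : ℤ × ℤ} (hyz : PlaneAdj y z) (hyp : PlaneAdj y p)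
    (hzp : PlaneAdj z p) (hyq : PlaneAdj y q) (hzq : PlaneAdj z q) (hyr : PlaneAdj y r)
    (hzr : PlaneAdj z r) (hpq : p ≠ q) (hpr : p ≠ r) : q = r := by
  have h1 := apex_cases hyz hyp hzp
  have h2 := apex_cases hyz hyq hzq
  have h3 := apex_cases hyz hyr hzr
  rw [ne_eq, Prod.ext_iff] at hpq hpr
  rw [Prod.ext_iff]
  omega

section Frame

variable {u w : ℤ × ℤ}

theorem IsFrame.adj₁ (h : IsFrame u w) (x : ℤ × ℤ) : PlaneAdj x (x + u) := by
  rcases h.cases with ⟨rfl, rfl⟩ | ⟨rfl, rfl⟩ | ⟨rfl, rfl⟩ | ⟨rfl, rfl⟩ | ⟨rfl, rfl⟩ | ⟨rfl, rfl⟩ <;>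
    simp [PlaneAdj, sub_eq_add_neg]

theorem IsFrame.adj₂ (h : IsFrame u w) (x : ℤ × ℤ) : PlaneAdj x (x + w) := by
  rcases h.cases with ⟨rfl, rfl⟩ | ⟨rfl, rfl⟩ | ⟨rfl, rfl⟩ | ⟨rfl, rfl⟩ | ⟨rfl, rfl⟩ | ⟨rfl, rfl⟩ <;>
    simp [PlaneAdj, sub_eq_add_neg]

theorem IsFrame.adj₃ (h : IsFrame u w) (x : ℤ × ℤ) : PlaneAdj (x + u) (x + w) := by
  rcases h.cases with ⟨rfl, rfl⟩ | ⟨rfl, rfl⟩ | ⟨rfl, rfl⟩ | ⟨rfl, rfl⟩ | ⟨rfl, rfl⟩ | ⟨rfl, rfl⟩ <;>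
    simp [PlaneAdj, sub_eq_add_neg, add_assoc]

theorem IsFrame.adj₄ (h : IsFrame u w) (x : ℤ × ℤ) : PlaneAdj (x + u) (x + u + w) :=
  h.adj₂ _

theorem IsFrame.adj₅ (h : IsFrame u w) (x : ℤ × ℤ) : PlaneAdj (x + w) (x + u + w) := by
  rw [add_right_comm]
  exact h.adj₁ _

theorem IsFrame.far_ne (h : IsFrame u w) (x : ℤ × ℤ) : x ≠ x + u + w := by
  rcases h.cases with ⟨rfl, rfl⟩ | ⟨rfl, rfl⟩ | ⟨rfl, rfl⟩ | ⟨rfl, rfl⟩ | ⟨rfl, rfl⟩ | ⟨rfl, rfl⟩ <;>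
    simp [Prod.ext_iff, add_assoc]

theorem IsFrame.near_mem (h : IsFrame u w) (x : ℤ × ℤ) :
    {x, x + u, x + w} ∈ coxeterPlane.faces := by
  obtain ⟨x1, x2⟩ := x
  refine ⟨by simp, x1 + min 0 (min u.1 w.1), x2 + min 0 (min u.2 w.2), ?_⟩
  rcases h.cases with ⟨rfl, rfl⟩ | ⟨rfl, rfl⟩ | ⟨rfl, rfl⟩ | ⟨rfl, rfl⟩ | ⟨rfl, rfl⟩ | ⟨rfl, rfl⟩ <;>
    simp [upTriangle, downTriangle, Finset.insert_subset_iff]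

theorem IsFrame.far_mem (h : IsFrame u w) (x : ℤ × ℤ) :
    {x + u, x + w, x + u + w} ∈ coxeterPlane.faces := by
  obtain ⟨x1, x2⟩ := x
  refine ⟨by simp, x1 + min u.1 (min w.1 (u.1 + w.1)), x2 + min u.2 (min w.2 (u.2 + w.2)), ?_⟩
  rcases h.cases with ⟨rfl, rfl⟩ | ⟨rfl, rfl⟩ | ⟨rfl, rfl⟩ | ⟨rfl, rfl⟩ | ⟨rfl, rfl⟩ | ⟨rfl, rfl⟩ <;>
    simp [upTriangle, downTriangle, Finset.insert_subset_iff, add_assoc]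

/-- Every property of points which holds for the vertices of one chamber and can be carried across
edges holds for all points. -/
theorem flip_induction {K : ℤ × ℤ → Prop} (h0 : K (0, 0)) (h1 : K (1, 0)) (h2 : K (0, 1))
    (flip : ∀ x u w, IsFrame u w → K x → K (x + u) → K (x + w) → K (x + u + w)) (p : ℤ × ℤ) :
    K p := by
  have flip' : ∀ x u w a b c : ℤ × ℤ, IsFrame u w → K x → K a → K b → a = x + u → b = x + w →
      c = x + u + w → K c := by
    rintro x u w a b c h hx ha hb rfl rfl rfl
    exact flip x u w h hx ha hb
  let P : ℤ → ℤ → Prop := fun i j => K (i, j) ∧ K (i + 1, j) ∧ K (i, j + 1)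
  have right : ∀ i j, P i j → P (i + 1) j := by
    rintro i j ⟨a, b, c⟩
    have d : K (i + 1, j + 1) := flip' (i, j) (1, 0) (0, 1) _ _ _ (by simp [IsFrame]) a b c
      (by simp) (by simp) (by simp)
    exact ⟨b, flip' (i, j + 1) (1, 0) (1, -1) _ _ _ (by simp [IsFrame]) c d b
      (by simp) (by simp) (by simp), d⟩
  have up : ∀ i j, P i j → P i (j + 1) := by
    rintro i j ⟨a, b, c⟩
    have d : K (i + 1, j + 1) := flip' (i, j) (1, 0) (0, 1) _ _ _ (by simp [IsFrame]) a b c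
      (by simp) (by simp) (by simp)
    exact ⟨c, d, flip' (i + 1, j) (-1, 1) (0, 1) _ _ _ (by simp [IsFrame]) b c d
      (by simp) (by simp) (by simp)⟩
  have left : ∀ i j, P i j → P (i - 1) j := by
    rintro i j ⟨a, b, c⟩
    have d : K (i - 1, j + 1) := flip' (i + 1, j) (-1, 1) (-1, 0) _ _ _ (by simp [IsFrame]) b c a
      (by simp) (by simp) (by simp; ring)
    refine ⟨flip' (i, j + 1) (0, -1) (-1, 0) _ _ _ (by simp [IsFrame]) c a d
      (by simp) (by simp; ring) (by simp; ring), by simpa using a, d⟩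
  have down : ∀ i j, P i j → P i (j - 1) := by
    rintro i j ⟨a, b, c⟩
    have d : K (i + 1, j - 1) := flip' (i, j + 1) (0, -1) (1, -1) _ _ _ (by simp [IsFrame]) c a b
      (by simp) (by simp) (by simp; ring)
    refine ⟨flip' (i + 1, j) (0, -1) (-1, 0) _ _ _ (by simp [IsFrame]) b d a
      (by simp; ring) (by simp) (by simp; ring), d, by simpa using a⟩
  have row : ∀ i, P i 0 := by
    intro i
    induction i using Int.induction_on with
    | zero => exact ⟨h0, h1, h2⟩
    | succ i ih => exact right _ _ ih
    | pred i ih => exact left _ _ ih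
  have all : ∀ i j, P i j := by
    intro i j
    induction j using Int.induction_on with
    | zero => exact row i
    | succ j ih => exact up _ _ ih
    | pred j ih => exact down _ _ ih
  exact (all p.1 p.2).1

/-- The determinant of a frame, which is `1` or `-1`. -/
def frameDet (u w : ℤ × ℤ) : ℤ := u.1 * w.2 - u.2 * w.1

/-- The type preserving symmetry `(i, j) ↦ x + i u + j w` of the plane. -/
def frameEquiv (x u w : ℤ × ℤ) (h : IsFrame u w) : ℤ × ℤ ≃ ℤ × ℤ where
  toFun p := (x.1 + p.1 * u.1 + p.2 * w.1, x.2 + p.1 * u.2 + p.2 * w.2)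
  invFun p := (frameDet u w * ((p.1 - x.1) * w.2 - (p.2 - x.2) * w.1),
    frameDet u w * (u.1 * (p.2 - x.2) - u.2 * (p.1 - x.1)))
  left_inv p := by
    rcases h.cases with
      ⟨rfl, rfl⟩ | ⟨rfl, rfl⟩ | ⟨rfl, rfl⟩ | ⟨rfl, rfl⟩ | ⟨rfl, rfl⟩ | ⟨rfl, rfl⟩ <;>
    ext <;> simp [frameDet] <;> ring
  right_inv p := by
    rcases h.cases with
      ⟨rfl, rfl⟩ | ⟨rfl, rfl⟩ | ⟨rfl, rfl⟩ | ⟨rfl, rfl⟩ | ⟨rfl, rfl⟩ | ⟨rfl, rfl⟩ <;>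
    ext <;> simp [frameDet] <;> ring

variable (x : ℤ × ℤ) (h : IsFrame u w)

theorem frameEquiv_apply (p : ℤ × ℤ) :
    frameEquiv x u w h p = (x.1 + p.1 * u.1 + p.2 * w.1, x.2 + p.1 * u.2 + p.2 * w.2) := rfl

theorem frameEquiv_symm_apply (p : ℤ × ℤ) : (frameEquiv x u w h).symm p =
    (frameDet u w * ((p.1 - x.1) * w.2 - (p.2 - x.2) * w.1),
      frameDet u w * (u.1 * (p.2 - x.2) - u.2 * (p.1 - x.1))) := rfl

@[simp] theorem frameEquiv_zero : frameEquiv x u w h (0, 0) = x := by simp [frameEquiv_apply]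

@[simp] theorem frameEquiv_one_zero : frameEquiv x u w h (1, 0) = x + u := by
  ext <;> simp [frameEquiv_apply]

@[simp] theorem frameEquiv_zero_one : frameEquiv x u w h (0, 1) = x + w := by
  ext <;> simp [frameEquiv_apply]

@[simp] theorem frameEquiv_one_one : frameEquiv x u w h (1, 1) = x + u + w := by
  ext <;> simp [frameEquiv_apply]

theorem map_frameEquiv_mem {s : Finset (ℤ × ℤ)} (hs : s ∈ coxeterPlane.faces) :
    s.map (frameEquiv x u w h).toEmbedding ∈ coxeterPlane.faces := by
  obtain ⟨hne, i, j, hs | hs⟩ := hs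
  · refine mem_plane_of_subset (h.near_mem (frameEquiv x u w h (i, j)))
      ((Finset.map_subset_map.2 hs).trans ?_) (hne.map)
    simp [upTriangle, Finset.insert_subset_iff, frameEquiv_apply, Prod.ext_iff, add_mul]
    refine ⟨Or.inr (Or.inl ⟨?_, ?_⟩), Or.inr (Or.inr ⟨?_, ?_⟩)⟩ <;> ring
  · refine mem_plane_of_subset (h.far_mem (frameEquiv x u w h (i, j)))
      ((Finset.map_subset_map.2 hs).trans ?_) (hne.map)
    simp [downTriangle, Finset.insert_subset_iff, frameEquiv_apply, Prod.ext_iff, add_mul]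
    refine ⟨?_, ?_, ?_⟩ <;> ring_nf <;> simp

/-- The inverse of a frame symmetry is again one: the columns of the inverse matrix form a frame,
and the base point is the preimage of the origin. -/
theorem map_frameEquiv_symm_mem {s : Finset (ℤ × ℤ)} (hs : s ∈ coxeterPlane.faces) :
    s.map (frameEquiv x u w h).symm.toEmbedding ∈ coxeterPlane.faces := by
  have h' : IsFrame (frameDet u w * w.2, - (frameDet u w * u.2))
      (-(frameDet u w * w.1), frameDet u w * u.1) := by
    rcases h.cases with
      ⟨rfl, rfl⟩ | ⟨rfl, rfl⟩ | ⟨rfl, rfl⟩ | ⟨rfl, rfl⟩ | ⟨rfl, rfl⟩ | ⟨rfl, rfl⟩ <;>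
    simp [frameDet, IsFrame]
  have := map_frameEquiv_mem ((frameEquiv x u w h).symm 0) h' hs
  convert this using 2
  ext p <;> simp [frameEquiv_apply, frameEquiv_symm_apply] <;> ring

/-- In every frame `u` has type `1` and `w` has type `-1` modulo 3. -/
theorem frameEquiv_type (p : ℤ × ℤ) :
    (((frameEquiv x u w h p).1 : ℤ) : ZMod 3) - ((frameEquiv x u w h p).2 : ℤ) =
      (x.1 - x.2 : ZMod 3) + p.1 - p.2 := by
  have h3 : (3 : ZMod 3) = 0 := rfl
  rcases h.cases with
      ⟨rfl, rfl⟩ | ⟨rfl, rfl⟩ | ⟨rfl, rfl⟩ | ⟨rfl, rfl⟩ | ⟨rfl, rfl⟩ | ⟨rfl, rfl⟩ <;>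
    simp only [frameEquiv_apply] <;> push_cast
  · ring
  · linear_combination (p.2 : ZMod 3) * h3
  · ring
  · linear_combination (p.2 : ZMod 3) * h3
  · linear_combination (-(p.1 : ZMod 3)) * h3
  · linear_combination (-(p.1 : ZMod 3)) * h3

end Frame

namespace TriangleBuilding

variable {V : Type*} (B : TriangleBuilding V)

/-! ### Charts of apartments -/

/-- A flat is an injective simplicial map of the Coxeter complex into the building such that types
increase by one along the first basis vector and decrease by one along the second. -/
def IsFlat (f : ℤ × ℤ ↪ V) : Prop :=
  (∀ s ∈ coxeterPlane.faces, s.map f ∈ B.complex) ∧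
    ∀ i j : ℤ, B.type (f (i, j)) = B.type (f (0, 0)) + (i : ZMod 3) - (j : ZMod 3)

variable {B}

theorem map_mem_of_isChart {S : PreAbstractSimplicialComplex V} {φ : ℤ × ℤ ↪ V} (h : IsChart S φ)
    {s : Finset (ℤ × ℤ)} (hs : s ∈ coxeterPlane.faces) : s.map φ ∈ S := by
  change s.map φ ∈ S.faces
  rw [h]
  exact ⟨s, hs, rfl⟩

theorem exists_of_mem_of_isChart {S : PreAbstractSimplicialComplex V} {φ : ℤ × ℤ ↪ V}
    (h : IsChart S φ) {t : Finset V} (ht : t ∈ S) : ∃ s ∈ coxeterPlane.faces, s.map φ = t := by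
  have : t ∈ S.faces := ht
  rwa [h] at this

theorem exists_point_of_isChart {S : PreAbstractSimplicialComplex V} {φ ψ : ℤ × ℤ ↪ V}
    (h : IsChart S φ) (h' : IsChart S ψ) (p : ℤ × ℤ) : ∃ q, φ p = ψ q := by
  have h1 := map_mem_of_isChart h (singleton_mem_plane p)
  obtain ⟨s, hs, hs'⟩ := exists_of_mem_of_isChart h' h1
  have : φ p ∈ s.map ψ := by rw [hs']; simp
  obtain ⟨q, -, hq⟩ := Finset.mem_map.1 this
  exact ⟨q, hq.symm⟩

theorem planeAdj_of_isChart {S : PreAbstractSimplicialComplex V} {φ ψ : ℤ × ℤ ↪ V}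
    (h : IsChart S φ) (h' : IsChart S ψ) {p p' q q' : ℤ × ℤ} (hp : PlaneAdj p p')
    (hq : φ p = ψ q) (hq' : φ p' = ψ q') : PlaneAdj q q' := by
  obtain ⟨s, hs, hs'⟩ := exists_of_mem_of_isChart h' (map_mem_of_isChart h (pair_mem_plane hp))
  have h1 : q ∈ s := by
    rw [← Finset.mem_map' ψ, hs', ← hq]
    simp
  have h2 : q' ∈ s := by
    rw [← Finset.mem_map' ψ, hs', ← hq']
    simp
  refine planeAdj_of_mem hs h1 h2 ?_
  rintro rfl
  exact hp.ne (φ.injective (hq.trans hq'.symm))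

theorem IsOrientedChart.isFlat {φ : ℤ × ℤ ↪ V} (h : B.IsOrientedChart φ) : B.IsFlat φ := by
  obtain ⟨⟨S, hS, h⟩, h'⟩ := h
  exact ⟨fun s hs => B.apartment_le S hS (map_mem_of_isChart h hs), h'⟩

theorem IsOrientedChart.comp_frame {φ : ℤ × ℤ ↪ V} (hφ : B.IsOrientedChart φ) (x : ℤ × ℤ)
    {u w : ℤ × ℤ} (h : IsFrame u w) :
    B.IsOrientedChart ((frameEquiv x u w h).toEmbedding.trans φ) := by
  obtain ⟨⟨S, hS, hφ⟩, ht⟩ := hφ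
  refine ⟨⟨S, hS, ?_⟩, fun i j => ?_⟩
  · rw [IsChart, hφ]
    ext t
    constructor
    · rintro ⟨s, hs, rfl⟩
      refine ⟨_, map_frameEquiv_symm_mem x h hs, ?_⟩
      rw [Finset.map_map]
      congr 1
      ext p
      simp
    · rintro ⟨s, hs, rfl⟩
      exact ⟨_, map_frameEquiv_mem x h hs, Finset.map_map _ _ _⟩
  · have h1 := frameEquiv_type x h (i, j)
    have h2 := frameEquiv_type x h (0, 0)
    simp only [Function.Embedding.trans_apply, Equiv.coe_toEmbedding]
    rw [ht, ht (frameEquiv x u w h (0, 0)).1]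
    simp only [Int.cast_zero] at h1 h2
    linear_combination h1 - h2

theorem IsFlat.comp_frame {f : ℤ × ℤ ↪ V} (hf : B.IsFlat f) (x : ℤ × ℤ)
    {u w : ℤ × ℤ} (h : IsFrame u w) :
    B.IsFlat ((frameEquiv x u w h).toEmbedding.trans f) := by
  refine ⟨fun s hs => ?_, fun i j => ?_⟩
  · rw [← Finset.map_map]
    exact hf.1 _ (map_frameEquiv_mem x h hs)
  · have h1 := frameEquiv_type x h (i, j)
    have h2 := frameEquiv_type x h (0, 0)
    have ht := hf.2
    simp only [Function.Embedding.trans_apply, Equiv.coe_toEmbedding]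
    rw [ht, ht (frameEquiv x u w h (0, 0)).1]
    simp only [Int.cast_zero] at h1 h2
    linear_combination h1 - h2

theorem zmod3_third {a b c d : ZMod 3} (hab : a ≠ b) (hac : a ≠ c) (hbc : b ≠ c) (hdb : d ≠ b)
    (hdc : d ≠ c) : d = a := by
  have : ∀ a b c d : ZMod 3, a ≠ b ∧ a ≠ c ∧ b ≠ c ∧ d ≠ b ∧ d ≠ c → d = a := by decide
  exact this a b c d ⟨hab, hac, hbc, hdb, hdc⟩

theorem type_ne_of_chart {S : PreAbstractSimplicialComplex V} (hS : S ∈ B.apartments)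
    {φ : ℤ × ℤ ↪ V} (h : IsChart S φ) {p q : ℤ × ℤ} (hpq : PlaneAdj p q) :
    B.type (φ p) ≠ B.type (φ q) := by
  intro he
  have := B.apartment_le S hS (map_mem_of_isChart h (pair_mem_plane hpq))
  have := B.type_injOn _ this (by simp) (by simp) he
  exact hpq.ne (φ.injective this)

/-- A proper 3-colouring of the triangular lattice is determined by one chamber: across an edge the
new vertex takes the colour of the opposite one, and the linear form is unchanged modulo 3 because
`u + w` has type 0. -/
theorem type_formula {c : ℤ × ℤ → ZMod 3} (hc : ∀ p q, PlaneAdj p q → c p ≠ c q) (p : ℤ × ℤ) :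
    c p = c (0, 0) + (c (1, 0) - c (0, 0)) * ((p.1 : ZMod 3) - p.2) := by
  refine flip_induction (K := fun p =>
    c p = c (0, 0) + (c (1, 0) - c (0, 0)) * ((p.1 : ZMod 3) - p.2)) ?_ ?_ ?_ ?_ p
  · simp
  · simp
  · have h1 := hc (0, 0) (1, 0) (by simp [PlaneAdj])
    have h2 := hc (0, 0) (0, 1) (by simp [PlaneAdj])
    have h3 := hc (1, 0) (0, 1) (by simp [PlaneAdj])
    simp only [Int.cast_zero, Int.cast_one]
    generalize c (0, 0) = a at *
    generalize c (1, 0) = b at *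
    generalize c (0, 1) = d at *
    revert a b d
    decide
  · intro x u w h hx hu hw
    have e : c (x + u + w) = c x := zmod3_third (hc _ _ (h.adj₁ x)) (hc _ _ (h.adj₂ x))
      (hc _ _ (h.adj₃ x)) (hc _ _ (h.adj₄ x).symm) (hc _ _ (h.adj₅ x).symm)
    have h0 : ((((x + u + w).1 : ℤ) : ZMod 3) - ((x + u + w).2 : ℤ)) = (x.1 : ZMod 3) - x.2 := by
      have h3 : (3 : ZMod 3) = 0 := rfl
      rcases h.cases with
        ⟨rfl, rfl⟩ | ⟨rfl, rfl⟩ | ⟨rfl, rfl⟩ | ⟨rfl, rfl⟩ | ⟨rfl, rfl⟩ | ⟨rfl, rfl⟩ <;>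
      simp only [Prod.fst_add, Prod.snd_add] <;> push_cast
      · ring
      · linear_combination h3
      · ring
      · linear_combination h3
      · linear_combination -h3
      · linear_combination -h3
    rw [h0, e, hx]

theorem isChart_swap {S : PreAbstractSimplicialComplex V} {φ : ℤ × ℤ ↪ V} (h : IsChart S φ) :
    IsChart S ((Equiv.prodComm ℤ ℤ).toEmbedding.trans φ) := by
  have key : ∀ s ∈ coxeterPlane.faces,
      s.map (Equiv.prodComm ℤ ℤ).toEmbedding ∈ coxeterPlane.faces := by
    rintro s ⟨hne, i, j, hs⟩
    refine ⟨hne.map, j, i, ?_⟩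
    rcases hs with hs | hs
    · left
      refine (Finset.map_subset_map.2 hs).trans ?_
      simp [upTriangle, Finset.insert_subset_iff]
    · right
      refine (Finset.map_subset_map.2 hs).trans ?_
      simp [downTriangle, Finset.insert_subset_iff]
  rw [IsChart, h]
  ext t
  constructor
  · rintro ⟨s, hs, rfl⟩
    refine ⟨_, key s hs, ?_⟩
    rw [Finset.map_map]
    congr 1
  · rintro ⟨s, hs, rfl⟩
    exact ⟨_, key s hs, Finset.map_map _ _ _⟩

/-- By `type_formula`, types along the first basis vector either always rise or always fall by one;
in the second case exchanging the coordinates repairs the orientation. -/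
theorem exists_orientedChart {S : PreAbstractSimplicialComplex V} (hS : S ∈ B.apartments) :
    ∃ φ : ℤ × ℤ ↪ V, IsChart S φ ∧ B.IsOrientedChart φ := by
  obtain ⟨φ, h⟩ := B.exists_chart S hS
  have ht := type_formula (c := fun p => B.type (φ p)) fun p q hpq => type_ne_of_chart hS h hpq
  have h01 := type_ne_of_chart hS h (p := (0, 0)) (q := (1, 0)) (by simp [PlaneAdj])
  have hε : B.type (φ (1, 0)) - B.type (φ (0, 0)) = 1 ∨
      B.type (φ (1, 0)) - B.type (φ (0, 0)) = -1 := by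
    clear ht
    generalize B.type (φ (1, 0)) = a at *
    generalize B.type (φ (0, 0)) = b at *
    decide +revert
  rcases hε with hε | hε
  · refine ⟨φ, h, ⟨S, hS, h⟩, fun i j => ?_⟩
    rw [ht (i, j), hε]
    ring
  · refine ⟨_, isChart_swap h, ⟨S, hS, isChart_swap h⟩, fun i j => ?_⟩
    simp only [Function.Embedding.trans_apply, Equiv.coe_toEmbedding, Equiv.prodComm_apply,
      Prod.swap_prod_mk]
    rw [ht (j, i), hε]
    ring

/-- The position of a vertex in an apartment which contains a given chamber is determined by the
chamber. -/
theorem eq_of_chart_eq {φ φ' : ℤ × ℤ ↪ V} (h : B.IsOrientedChart φ) (h' : B.IsOrientedChart φ')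
    (h0 : φ (0, 0) = φ' (0, 0)) (h1 : φ (1, 0) = φ' (1, 0)) (h2 : φ (0, 1) = φ' (0, 1))
    {p p' : ℤ × ℤ} (hp : φ p = φ' p') : p = p' := by
  obtain ⟨⟨S, hS, h⟩, -⟩ := h
  obtain ⟨⟨S', hS', h'⟩, -⟩ := h'
  have hT := isFrame_std.near_mem (0, 0)
  have hTmap : Finset.map φ {(0, 0), (0, 0) + (1, 0), (0, 0) + (0, 1)} =
      Finset.map φ' {(0, 0), (0, 0) + (1, 0), (0, 0) + (0, 1)} := by
    classical
    simp [h0, h1, h2]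
  have hpmap : Finset.map φ {p} = Finset.map φ' {p'} := by simp [hp]
  obtain ⟨ψ, ψ', hψ, hψ', hψψ'⟩ := B.exists_iso S hS S' hS'
    (Finset.map φ {(0, 0), (0, 0) + (1, 0), (0, 0) + (0, 1)}) (Finset.map φ {p})
    (map_mem_of_isChart h hT) (by rw [hTmap]; exact map_mem_of_isChart h' hT)
    (map_mem_of_isChart h (singleton_mem_plane p))
    (by rw [hpmap]; exact map_mem_of_isChart h' (singleton_mem_plane p'))
  -- The coordinate changes from `φ` to `ψ` and from `φ'` to `ψ'` coincide: they agree on the base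
  -- chamber, which the isomorphism fixes, and both preserve adjacency, so agreement spreads across
  -- edges.
  have key : ∀ p, ∃ q, φ p = ψ q ∧ φ' p = ψ' q := by
    have base : ∀ p, p ∈ ({(0, 0), (0, 0) + (1, 0), (0, 0) + (0, 1)} : Finset (ℤ × ℤ)) →
        φ p = φ' p → ∃ q, φ p = ψ q ∧ φ' p = ψ' q := by
      intro p hp he
      obtain ⟨q, hq⟩ := exists_point_of_isChart h hψ p
      refine ⟨q, hq, ?_⟩
      rw [hψψ' q (Or.inl (by rw [← hq]; exact Finset.mem_map_of_mem _ hp)), ← he, hq]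
    refine flip_induction (base _ (by simp) h0) (base _ (by simp) h1) (base _ (by simp) h2) ?_
    rintro x u w hf ⟨q0, a0, b0⟩ ⟨q1, a1, b1⟩ ⟨q2, a2, b2⟩
    obtain ⟨q3, a3⟩ := exists_point_of_isChart h hψ (x + u + w)
    obtain ⟨q4, b4⟩ := exists_point_of_isChart h' hψ' (x + u + w)
    have : q3 = q4 := by
      refine apex_unique (p := q0) (planeAdj_of_isChart h hψ (hf.adj₃ x) a1 a2)
        (planeAdj_of_isChart h hψ (hf.adj₁ x).symm a1 a0)
        (planeAdj_of_isChart h hψ (hf.adj₂ x).symm a2 a0)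
        (planeAdj_of_isChart h hψ (hf.adj₄ x) a1 a3)
        (planeAdj_of_isChart h hψ (hf.adj₅ x) a2 a3)
        (planeAdj_of_isChart h' hψ' (hf.adj₄ x) b1 b4)
        (planeAdj_of_isChart h' hψ' (hf.adj₅ x) b2 b4) ?_ ?_
      · rintro rfl
        exact hf.far_ne x (φ.injective (a0.trans a3.symm))
      · rintro rfl
        exact hf.far_ne x (φ'.injective (b0.trans b4.symm))
    subst this
    exact ⟨q3, a3, b4⟩
  obtain ⟨q, a, b⟩ := key p
  obtain ⟨q', a', b'⟩ := key p'
  have e : ψ' q = ψ q := hψψ' q (Or.inr (by simp [a]))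
  have : q = q' := ψ'.injective (by rw [e, ← a, hp, b'])
  subst this
  exact φ.injective (a.trans a'.symm)

/-- A chamber and a simplex lie in a common apartment. -/
theorem exists_chart_through {f : ℤ × ℤ ↪ V} (hf : B.IsFlat f) {t : Finset V}
    (ht : t ∈ B.complex) : ∃ φ : ℤ × ℤ ↪ V, B.IsOrientedChart φ ∧ φ (0, 0) = f (0, 0) ∧
      φ (1, 0) = f (1, 0) ∧ φ (0, 1) = f (0, 1) ∧ ∃ t0 ∈ coxeterPlane.faces, t0.map φ = t := by
  have hT := hf.1 _ (isFrame_std.near_mem (0, 0))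
  obtain ⟨S, hS, hTS, htS⟩ := B.exists_apartment _ hT t ht
  obtain ⟨ψ, hψ, hψo⟩ := exists_orientedChart hS
  obtain ⟨s, hs, hsT⟩ := exists_of_mem_of_isChart hψ hTS
  have pt : ∀ p, p ∈ ({(0, 0), (0, 0) + (1, 0), (0, 0) + (0, 1)} : Finset (ℤ × ℤ)) →
      ∃ q ∈ s, ψ q = f p := by
    intro p hp
    have : f p ∈ s.map ψ := by rw [hsT]; exact Finset.mem_map_of_mem _ hp
    simpa using this
  obtain ⟨p0, hp0, e0⟩ := pt (0, 0) (by simp)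
  obtain ⟨p1, hp1, e1⟩ := pt (1, 0) (by simp)
  obtain ⟨p2, hp2, e2⟩ := pt (0, 1) (by simp)
  have n01 : p0 ≠ p1 := by
    rintro rfl
    simpa using f.injective (e0.symm.trans e1)
  have n02 : p0 ≠ p2 := by
    rintro rfl
    simpa using f.injective (e0.symm.trans e2)
  have n12 : p1 ≠ p2 := by
    rintro rfl
    simpa using f.injective (e1.symm.trans e2)
  have a01 := planeAdj_of_mem hs hp0 hp1 n01
  have a02 := planeAdj_of_mem hs hp0 hp2 n02
  have a12 := planeAdj_of_mem hs hp1 hp2 n12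
  have t1 : ((p1.1 - p0.1 - (p1.2 - p0.2) : ℤ) : ZMod 3) = 1 := by
    have h1 := hf.2 1 0
    rw [← e0, ← e1, hψo.2 p0.1, hψo.2 p1.1] at h1
    push_cast at h1 ⊢
    linear_combination h1
  have t2 : ((p2.1 - p0.1 - (p2.2 - p0.2) : ℤ) : ZMod 3) = -1 := by
    have h1 := hf.2 0 1
    rw [← e0, ← e2, hψo.2 p0.1, hψo.2 p2.1] at h1
    push_cast at h1 ⊢
    linear_combination h1
  -- Of the six neighbours of a point three have type `+1` and three have type `-1`; the types
  -- therefore select `u` and `w`, and adjacency of `p1` and `p2` excludes opposite vectors.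
  have hfr : IsFrame (p1 - p0) (p2 - p0) := by
    have u1 : (p1 - p0 = (1, 0) ∨ p1 - p0 = (0, -1) ∨ p1 - p0 = (-1, 1)) := by
      rcases a01 with h | h | h | h | h | h
      · left; ext <;> simp [h]
      · simp [h] at t1; exact absurd t1 (by decide)
      · right; right; ext <;> simp [h]
      · simp [h] at t1; exact absurd t1 (by decide)
      · right; left; ext <;> simp [h]
      · simp [h] at t1; exact absurd t1 (by decide)
    have u2 : (p2 - p0 = (-1, 0) ∨ p2 - p0 = (0, 1) ∨ p2 - p0 = (1, -1)) := by
      rcases a02 with h | h | h | h | h | h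
      · simp [h] at t2; exact absurd t2 (by decide)
      · right; left; ext <;> simp [h]
      · simp [h] at t2; exact absurd t2 (by decide)
      · left; ext <;> simp [h]
      · simp [h] at t2; exact absurd t2 (by decide)
      · right; right; ext <;> simp [h]
    refine ⟨u1, u2, fun h => ?_⟩
    simp only [Prod.ext_iff, Prod.fst_sub, Prod.snd_sub, Prod.fst_neg, Prod.snd_neg] at h u1 u2
    unfold PlaneAdj at a12
    omega
  refine ⟨_, hψo.comp_frame p0 hfr, ?_, ?_, ?_, ?_⟩
  · simp [e0]
  · simp [e1]
  · simp [e2]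
  · obtain ⟨t0, ht0, ht0'⟩ := exists_of_mem_of_isChart hψ htS
    refine ⟨_, map_frameEquiv_symm_mem p0 hfr ht0, ?_⟩
    rw [Finset.map_map, ← ht0']
    congr 1
    ext p
    simp

/-! ### Retractions and convexity -/

variable (B) in
/-- The vertex `v` is in position `p` with respect to the base chamber of the chart `φ`. -/
def HasPosition (φ : ℤ × ℤ ↪ V) (v : V) (p : ℤ × ℤ) : Prop :=
  ∃ ψ : ℤ × ℤ ↪ V, B.IsOrientedChart ψ ∧ ψ (0, 0) = φ (0, 0) ∧ ψ (1, 0) = φ (1, 0) ∧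
    ψ (0, 1) = φ (0, 1) ∧ ψ p = v

/-- With `exists_hasPosition_of_mem` this makes the relation a function, the retraction onto the
apartment of `φ` centred at the base chamber. -/
theorem HasPosition.unique {φ : ℤ × ℤ ↪ V} {v : V} {p q : ℤ × ℤ} (hp : B.HasPosition φ v p)
    (hq : B.HasPosition φ v q) : p = q := by
  obtain ⟨ψ, h, h0, h1, h2, h3⟩ := hp
  obtain ⟨ψ', h', h0', h1', h2', h3'⟩ := hq
  exact eq_of_chart_eq h h' (h0.trans h0'.symm) (h1.trans h1'.symm) (h2.trans h2'.symm)
    (h3.trans h3'.symm)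

theorem HasPosition.type_eq {φ : ℤ × ℤ ↪ V} {v : V} {p : ℤ × ℤ} (hp : B.HasPosition φ v p) :
    B.type v = B.type (φ (0, 0)) + (p.1 : ZMod 3) - p.2 := by
  obtain ⟨ψ, h, h0, -, -, rfl⟩ := hp
  rw [← h0]
  exact h.2 _ _

theorem exists_hasPosition_of_mem {φ : ℤ × ℤ ↪ V} (hφ : B.IsFlat φ) {t : Finset V}
    (ht : t ∈ B.complex) : ∃ t0 ∈ coxeterPlane.faces,
      ∀ v ∈ t, ∃ p ∈ t0, B.HasPosition φ v p := by
  obtain ⟨ψ, h, h0, h1, h2, t0, ht0, rfl⟩ := exists_chart_through hφ ht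
  refine ⟨t0, ht0, fun v hv => ?_⟩
  obtain ⟨p, hp, rfl⟩ := Finset.mem_map.1 hv
  exact ⟨p, hp, ψ, h, h0, h1, h2, rfl⟩

/-- The retraction is simplicial, and since it preserves types it cannot identify two vertices of a
simplex. -/
theorem HasPosition.adj {φ : ℤ × ℤ ↪ V} (hφ : B.IsFlat φ) {t : Finset V}
    (ht : t ∈ B.complex) {v w : V} (hv : v ∈ t) (hw : w ∈ t) (hne : v ≠ w) {p q : ℤ × ℤ}
    (hp : B.HasPosition φ v p) (hq : B.HasPosition φ w q) : PlaneAdj p q := by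
  obtain ⟨t0, ht0, h⟩ := exists_hasPosition_of_mem hφ ht
  obtain ⟨p', hp', hp''⟩ := h v hv
  obtain ⟨q', hq', hq''⟩ := h w hw
  obtain rfl := hp.unique hp''
  obtain rfl := hq.unique hq''
  refine planeAdj_of_mem ht0 hp' hq' ?_
  rintro rfl
  exact hne (B.type_injOn _ ht hv hw (hp.type_eq.trans hq.type_eq.symm))

theorem le_of_steps {k : ℤ × ℤ → ℤ} {d e : ℤ × ℤ} (hd : ∀ p, k (p + d) ≤ k p + 1)
    (he : ∀ p, k (p + e) ≤ k p + 1) (p : ℤ × ℤ) (n m : ℕ) :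
    k (p + n • d + m • e) ≤ k p + n + m := by
  induction m with
  | zero =>
    induction n with
    | zero => simp
    | succ n ih =>
      have := hd (p + n • d)
      rw [zero_smul, add_zero] at ih
      rw [zero_smul, add_zero, add_smul, one_smul, ← add_assoc]
      push_cast at *
      linarith
  | succ m ih =>
    have := he (p + n • d + m • e)
    rw [add_smul m, one_smul, ← add_assoc]
    push_cast at *
    linarith

/-- The core of the convexity argument. Retract `f` onto the apartment of `φ`, centred at the base
chamber, and call the result `g`. If the conclusion failed, `g` would fix `v` but send the origin to
its mirror image `(1, 1)`. A step of type `+1` raises `x + 2y` by at most 1, and a step of type `-1`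
raises `2x + y` by at most 1, while some path from `v` to the origin raises one of these forms by
exactly 1 at each step. So the form is at most 0 at the image of the origin, whereas it is 3 at `(1,
1)`. -/
theorem convex_base {φ f : ℤ × ℤ ↪ V} (hφ : B.IsOrientedChart φ) (hf : B.IsFlat f) {v : ℤ × ℤ}
    (h1 : φ (1, 0) = f (1, 0)) (h2 : φ (0, 1) = f (0, 1)) (hv : φ v = f v) (hlt : v.1 + v.2 < 1) :
    φ (0, 0) = f (0, 0) := by
  by_contra hne
  have hφf := hφ.isFlat
  have self : ∀ p, B.HasPosition φ (φ p) p := fun p => ⟨φ, hφ, rfl, rfl, rfl, rfl⟩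
  have ex : ∀ p, ∃ q, B.HasPosition φ (f p) q := by
    intro p
    obtain ⟨t0, -, h⟩ := exists_hasPosition_of_mem hφf (hf.1 _ (singleton_mem_plane p))
    obtain ⟨q, -, hq⟩ := h (f p) (by simp)
    exact ⟨q, hq⟩
  choose g hg using ex
  have gv : g v = v := by
    have := hg v
    rw [← hv] at this
    exact this.unique (self v)
  have g1 : g (1, 0) = (1, 0) := by
    have := hg (1, 0)
    rw [← h1] at this
    exact this.unique (self _)
  have g2 : g (0, 1) = (0, 1) := by
    have := hg (0, 1)
    rw [← h2] at this
    exact this.unique (self _)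
  have gadj : ∀ p q, PlaneAdj p q → PlaneAdj (g p) (g q) := fun p q hpq =>
    HasPosition.adj hφf (hf.1 _ (pair_mem_plane hpq)) (v := f p) (w := f q) (by simp) (by simp)
      (fun h => hpq.ne (f.injective h)) (hg p) (hg q)
  have g0 : g (0, 0) = (1, 1) := by
    -- Only the vertex `φ (0, 0)` itself is in position `(0, 0)`, because the charts which define
    -- positions all contain the base chamber.
    have hne0 : ((0, 0) : ℤ × ℤ) ≠ g (0, 0) := by
      intro h0
      have := hg (0, 0)
      rw [← h0] at this
      obtain ⟨ψ, -, e, -, -, e'⟩ := this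
      exact hne (e.symm.trans e')
    have a1 := gadj (1, 0) (0, 0) (by simp [PlaneAdj])
    have a2 := gadj (0, 1) (0, 0) (by simp [PlaneAdj])
    rw [g1] at a1
    rw [g2] at a2
    exact apex_unique (y := (1, 0)) (z := (0, 1)) (p := (0, 0)) (by simp [PlaneAdj])
      (by simp [PlaneAdj]) (by simp [PlaneAdj]) a1 a2 (by simp [PlaneAdj]) (by simp [PlaneAdj])
      hne0 (by simp)
  have gtype : ∀ p d : ℤ × ℤ,
      (((g (p + d)).1 - (g p).1 - ((g (p + d)).2 - (g p).2) : ℤ) : ZMod 3) =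
        ((d.1 - d.2 : ℤ) : ZMod 3) := by
    intro p d
    have e1 := (hg p).type_eq
    have e2 := (hg (p + d)).type_eq
    rw [hf.2] at e1 e2
    simp only [Prod.fst_add, Prod.snd_add] at e2
    push_cast at *
    linear_combination e1 - e2
  have step1 : ∀ d, (d = (1, 0) ∨ d = (-1, 1)) → ∀ p,
      (g (p + d)).1 + 2 * (g (p + d)).2 ≤ (g p).1 + 2 * (g p).2 + 1 := by
    intro d hd p
    have ha := gadj p (p + d) (by rcases hd with rfl | rfl <;> simp [PlaneAdj, sub_eq_add_neg])
    have ht := gtype p d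
    have ht' : ((d.1 - d.2 : ℤ) : ZMod 3) = 1 := by rcases hd with rfl | rfl <;> decide
    rw [ht'] at ht
    rcases ha with h | h | h | h | h | h
    · omega
    · simp [h] at ht; exact absurd ht (by decide)
    · omega
    · simp [h] at ht; exact absurd ht (by decide)
    · omega
    · simp [h] at ht; exact absurd ht (by decide)
  have step2 : ∀ d, (d = (0, 1) ∨ d = (1, -1)) → ∀ p,
      2 * (g (p + d)).1 + (g (p + d)).2 ≤ 2 * (g p).1 + (g p).2 + 1 := by
    intro d hd p
    have ha := gadj p (p + d) (by rcases hd with rfl | rfl <;> simp [PlaneAdj, sub_eq_add_neg])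
    have ht := gtype p d
    have ht' : ((d.1 - d.2 : ℤ) : ZMod 3) = -1 := by rcases hd with rfl | rfl <;> decide
    rw [ht'] at ht
    rcases ha with h | h | h | h | h | h
    · simp [h] at ht; exact absurd ht (by decide)
    · omega
    · simp [h] at ht; exact absurd ht (by decide)
    · omega
    · simp [h] at ht; exact absurd ht (by decide)
    · omega
  obtain ⟨v1, v2⟩ := v
  simp only at hlt
  -- The sign of `v2` decides which pair of directions reaches the origin from `v` with nonnegative
  -- multiplicities; when `v2 > 0`, the bound on `v1 + v2` makes `v1` negative.
  rcases le_or_gt v2 0 with hb | hb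
  · have := le_of_steps (k := fun p => (g p).1 + 2 * (g p).2) (step1 (1, 0) (by simp))
      (step1 (-1, 1) (by simp)) (v1, v2) (-v1 - v2).toNat (-v2).toNat
    have e : ((v1, v2) : ℤ × ℤ) + (-v1 - v2).toNat • ((1, 0) : ℤ × ℤ) +
        (-v2).toNat • ((-1, 1) : ℤ × ℤ) = (0, 0) := by
      ext <;> simp <;> omega
    rw [e] at this
    simp only [g0, gv] at this
    omega
  · have := le_of_steps (k := fun p => 2 * (g p).1 + (g p).2) (step2 (0, 1) (by simp))
      (step2 (1, -1) (by simp)) (v1, v2) (-v1 - v2).toNat (-v1).toNat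
    have e : ((v1, v2) : ℤ × ℤ) + (-v1 - v2).toNat • ((0, 1) : ℤ × ℤ) +
        (-v1).toNat • ((1, -1) : ℤ × ℤ) = (0, 0) := by
      ext <;> simp <;> omega
    rw [e] at this
    simp only [g0, gv] at this
    omega

/-- If a chart and a flat agree on an edge and on a point outside the line of this edge, then they
agree on the chamber which contains the edge and lies on the same side as the point. -/
theorem convex_frame {φ f : ℤ × ℤ ↪ V} (hφ : B.IsOrientedChart φ) (hf : B.IsFlat f)
    (x : ℤ × ℤ) {u w : ℤ × ℤ} (h : IsFrame u w) (a b : ℤ) (hab : a + b < 1)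
    (h1 : φ (x + u) = f (x + u)) (h2 : φ (x + w) = f (x + w))
    {y : ℤ × ℤ} (hy1 : y.1 = x.1 + a * u.1 + b * w.1) (hy2 : y.2 = x.2 + a * u.2 + b * w.2)
    (hv : φ y = f y) : φ x = f x := by
  have e : frameEquiv x u w h (a, b) = y := by
    rw [frameEquiv_apply, Prod.ext_iff]
    exact ⟨hy1.symm, hy2.symm⟩
  have := convex_base (hφ.comp_frame x h) (hf.comp_frame x h) (v := (a, b)) (by simpa using h1)
    (by simpa using h2) (by simpa [e] using hv) hab
  simpa using this

section Convex

variable {φ f : ℤ × ℤ ↪ V} (hφ : B.IsOrientedChart φ) (hf : B.IsFlat f) {i j : ℤ} {k l : ℤ}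
  (hv : φ (k, l) = f (k, l))

include hφ hf hv

/-- This and the next three lemmas specialise `convex_frame` to the edge directions; the integers
supplied are the coordinates of `(k, l)` in the frame at the new vertex. -/
theorem convex_antidiag (h1 : φ (i + 1, j) = f (i + 1, j)) (h2 : φ (i, j + 1) = f (i, j + 1))
    (h : k + l < i + j + 1) : φ (i, j) = f (i, j) := by
  refine convex_frame hφ hf (i, j) (u := (1, 0)) (w := (0, 1)) (by simp [IsFrame]) (k - i) (l - j)
    (by omega) ?_ ?_ (y := (k, l)) (by ring) (by ring) hv
  · simpa using h1
  · simpa using h2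

theorem convex_antidiag' (h1 : φ (i + 1, j) = f (i + 1, j)) (h2 : φ (i, j + 1) = f (i, j + 1))
    (h : i + j + 1 < k + l) : φ (i + 1, j + 1) = f (i + 1, j + 1) := by
  refine convex_frame hφ hf (i + 1, j + 1) (u := (0, -1)) (w := (-1, 0)) (by simp [IsFrame])
    (j + 1 - l) (i + 1 - k) (by omega) ?_ ?_ (y := (k, l)) (by ring) (by ring) hv
  · simpa using h1
  · simpa using h2

theorem convex_below (h1 : φ (i, j) = f (i, j)) (h2 : φ (i + 1, j) = f (i + 1, j))
    (h : l < j) : φ (i + 1, j - 1) = f (i + 1, j - 1) := by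
  refine convex_frame hφ hf (i + 1, j - 1) (u := (-1, 1)) (w := (0, 1)) (by simp [IsFrame])
    (i + 1 - k) (l - j - i + k) (by omega) ?_ ?_ (y := (k, l)) (by ring) (by ring) hv
  · simpa using h1
  · simpa using h2

theorem convex_left (h1 : φ (i, j) = f (i, j)) (h2 : φ (i, j + 1) = f (i, j + 1))
    (h : k < i) : φ (i - 1, j + 1) = f (i - 1, j + 1) := by
  refine convex_frame hφ hf (i - 1, j + 1) (u := (1, 0)) (w := (1, -1)) (by simp [IsFrame])
    (k - i - j + l) (j + 1 - l) (by omega) ?_ ?_ (y := (k, l)) (by ring) (by ring) hv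
  · simpa using h2
  · simpa using h1

end Convex

/-! ### Extension of charts across edges -/

/-- Take an apartment through the base chamber of `φ` and the simplex `t`. Positions relative to the
base chamber are unique, so the edge keeps its place; `x` is on the side of the origin and is kept
by convexity; the only place left for `z` is across the edge. -/
theorem exists_extension_frame {φ : ℤ × ℤ ↪ V} (hφ : B.IsOrientedChart φ) (x : ℤ × ℤ)
    {u w : ℤ × ℤ} (h : IsFrame u w) (a b : ℤ) (hab : a + b < 1)
    (h01 : 0 = x.1 + a * u.1 + b * w.1) (h02 : 0 = x.2 + a * u.2 + b * w.2)
    {t : Finset V} (ht : t ∈ B.complex) {z : V}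
    (hz : z ∈ t) (hu : φ (x + u) ∈ t) (hw : φ (x + w) ∈ t) (hzx : z ≠ φ x)
    (hzu : z ≠ φ (x + u)) (hzw : z ≠ φ (x + w)) :
    ∃ ψ : ℤ × ℤ ↪ V, B.IsOrientedChart ψ ∧ ψ (0, 0) = φ (0, 0) ∧ ψ x = φ x ∧
      ψ (x + u) = φ (x + u) ∧ ψ (x + w) = φ (x + w) ∧ ψ (x + u + w) = z := by
  obtain ⟨ψ, hψ, e0, e1, e2, t0, ht0, rfl⟩ := exists_chart_through hφ.isFlat ht
  obtain ⟨p, hp, rfl⟩ := Finset.mem_map.1 hz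
  obtain ⟨pu, hpu, eu⟩ := Finset.mem_map.1 hu
  obtain ⟨pw, hpw, ew⟩ := Finset.mem_map.1 hw
  obtain rfl := eq_of_chart_eq hψ hφ e0 e1 e2 eu
  obtain rfl := eq_of_chart_eq hψ hφ e0 e1 e2 ew
  have ex : ψ x = φ x := convex_frame hψ hφ.isFlat x h a b hab eu ew h01 h02 e0
  rw [← ex] at hzx
  rw [← eu] at hzu
  rw [← ew] at hzw
  have au := planeAdj_of_mem ht0 hpu hp fun he => hzu (by rw [he])
  have aw := planeAdj_of_mem ht0 hpw hp fun he => hzw (by rw [he])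
  have : p = x + u + w := by
    refine apex_unique (p := x) (h.adj₃ x) (h.adj₁ x).symm (h.adj₂ x).symm au aw (h.adj₄ x)
      (h.adj₅ x) (fun he => hzx (by rw [he])) (h.far_ne x)
  exact ⟨ψ, hψ, e0, ex, eu, ew, by rw [this]⟩

section Extension

variable {φ : ℤ × ℤ ↪ V} (hφ : B.IsOrientedChart φ) {i j : ℤ} {t : Finset V} (ht : t ∈ B.complex)
  {z : V} (hz : z ∈ t)

include hφ ht hz

theorem exists_extension_antidiag (h1 : φ (i + 1, j) ∈ t) (h2 : φ (i, j + 1) ∈ t)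
    (hij : 0 < i + j + 1) (hz0 : z ≠ φ (i, j)) (hz1 : z ≠ φ (i + 1, j)) (hz2 : z ≠ φ (i, j + 1)) :
    ∃ ψ : ℤ × ℤ ↪ V, B.IsOrientedChart ψ ∧ ψ (0, 0) = φ (0, 0) ∧ ψ (i, j) = φ (i, j) ∧
      ψ (i + 1, j) = φ (i + 1, j) ∧ ψ (i, j + 1) = φ (i, j + 1) ∧ ψ (i + 1, j + 1) = z := by
  have := exists_extension_frame hφ (i, j) (u := (1, 0)) (w := (0, 1)) (by simp [IsFrame])
    (-i) (-j) (by omega) (by simp) (by simp) ht hz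
  simp only [Prod.mk_add_mk, add_zero] at this
  exact this h1 h2 hz0 hz1 hz2

theorem exists_extension_above (h1 : φ (i, j) ∈ t) (h2 : φ (i + 1, j) ∈ t)
    (hj : 0 < j) (hz0 : z ≠ φ (i + 1, j - 1)) (hz1 : z ≠ φ (i, j)) (hz2 : z ≠ φ (i + 1, j)) :
    ∃ ψ : ℤ × ℤ ↪ V, B.IsOrientedChart ψ ∧ ψ (0, 0) = φ (0, 0) ∧
      ψ (i + 1, j - 1) = φ (i + 1, j - 1) ∧
      ψ (i, j) = φ (i, j) ∧ ψ (i + 1, j) = φ (i + 1, j) ∧ ψ (i, j + 1) = z := by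
  have := exists_extension_frame hφ (i + 1, j - 1) (u := (-1, 1)) (w := (0, 1)) (by simp [IsFrame])
    (i + 1) (- j - i) (by omega) (by ring) (by ring) ht hz
  simp only [Prod.mk_add_mk, add_zero, add_neg_cancel_right, sub_add_cancel] at this
  exact this h1 h2 hz0 hz1 hz2

theorem exists_extension_right (h1 : φ (i, j) ∈ t) (h2 : φ (i, j + 1) ∈ t)
    (hi : 0 < i) (hz0 : z ≠ φ (i - 1, j + 1)) (hz1 : z ≠ φ (i, j)) (hz2 : z ≠ φ (i, j + 1)) :
    ∃ ψ : ℤ × ℤ ↪ V, B.IsOrientedChart ψ ∧ ψ (0, 0) = φ (0, 0) ∧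
      ψ (i - 1, j + 1) = φ (i - 1, j + 1) ∧
      ψ (i, j) = φ (i, j) ∧ ψ (i, j + 1) = φ (i, j + 1) ∧ ψ (i + 1, j) = z := by
  have := exists_extension_frame hφ (i - 1, j + 1) (u := (1, 0)) (w := (1, -1)) (by simp [IsFrame])
    (- i - j) (j + 1) (by omega) (by ring) (by ring) ht hz
  simp only [Prod.mk_add_mk, add_zero, add_neg_cancel_right, sub_add_cancel] at this
  obtain ⟨ψ, hψ, e0, e1, e2, e3, e4⟩ := this h2 h1 hz0 hz2 hz1
  exact ⟨ψ, hψ, e0, e1, e3, e2, e4⟩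

end Extension

/-! ### Rectangles in charts -/

/-- The maps `φ` and `f` agree on the triangle with vertices `(i, j)`, `(i + 1, j)`, `(i, j + 1)`. -/
def AgreeUp (φ f : ℤ × ℤ → V) (i j : ℤ) : Prop :=
  φ (i, j) = f (i, j) ∧ φ (i + 1, j) = f (i + 1, j) ∧ φ (i, j + 1) = f (i, j + 1)

/-- The maps `φ` and `f` agree on the rectangle `[k, a] × [l, b]`. -/
def AgreeOn (φ f : ℤ × ℤ → V) (k a l b : ℤ) : Prop :=
  ∀ i j, k ≤ i → i ≤ a → l ≤ j → j ≤ b → φ (i, j) = f (i, j)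

theorem AgreeOn.mono {φ f : ℤ × ℤ → V} {k a l b k' a' l' b' : ℤ} (h : AgreeOn φ f k a l b)
    (hk : k ≤ k') (ha : a' ≤ a) (hl : l ≤ l') (hb : b' ≤ b) : AgreeOn φ f k' a' l' b' :=
  fun i j h1 h2 h3 h4 => h i j (by omega) (by omega) (by omega) (by omega)

theorem AgreeOn.symm {φ f : ℤ × ℤ → V} {k a l b : ℤ} (h : AgreeOn φ f k a l b) :
    AgreeOn f φ k a l b :=
  fun i j h1 h2 h3 h4 => (h i j h1 h2 h3 h4).symm

theorem AgreeOn.trans {φ f g : ℤ × ℤ → V} {k a l b : ℤ} (h : AgreeOn φ f k a l b)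
    (h' : AgreeOn f g k a l b) : AgreeOn φ g k a l b :=
  fun i j h1 h2 h3 h4 => (h i j h1 h2 h3 h4).trans (h' i j h1 h2 h3 h4)

theorem AgreeOn.agreeUp {φ f : ℤ × ℤ → V} {k a l b : ℤ} (h : AgreeOn φ f k a l b) {i j : ℤ}
    (hk : k ≤ i) (ha : i + 1 ≤ a) (hl : l ≤ j) (hb : j + 1 ≤ b) : AgreeUp φ f i j :=
  ⟨h _ _ (by omega) (by omega) (by omega) (by omega),
    h _ _ (by omega) (by omega) (by omega) (by omega),
    h _ _ (by omega) (by omega) (by omega) (by omega)⟩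

section

variable {φ f : ℤ × ℤ ↪ V} (hφ : B.IsOrientedChart φ) (hf : B.IsFlat f)
  (h0 : φ (0, 0) = f (0, 0))

include hφ hf h0

theorem AgreeUp.left {i j : ℤ} (h : AgreeUp φ f i j) (hi : 0 < i) (hj : 0 ≤ j) :
    AgreeUp φ f (i - 1) j := by
  obtain ⟨a, b, c⟩ := h
  have d := convex_left hφ hf h0 a c hi
  refine ⟨?_, by simpa using a, d⟩
  exact convex_antidiag hφ hf (i := i - 1) (j := j) h0 (by simpa using a) d (by omega)

theorem AgreeUp.below {i j : ℤ} (h : AgreeUp φ f i j) (hi : 0 ≤ i) (hj : 0 < j) :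
    AgreeUp φ f i (j - 1) := by
  obtain ⟨a, b, c⟩ := h
  have d := convex_below hφ hf h0 a b hj
  refine ⟨?_, d, by simpa using a⟩
  exact convex_antidiag hφ hf (i := i) (j := j - 1) h0 d (by simpa using a) (by omega)

/-- A chart and a flat which agree on a vertex and a chamber agree on their convex hull. -/
theorem AgreeUp.hull {a b : ℕ} (h : AgreeUp φ f a b) {i j : ℤ} (hi : 0 ≤ i) (hj : 0 ≤ j)
    (hia : i ≤ a) (hjb : j ≤ b) : AgreeUp φ f i j := by
  have row : ∀ n : ℕ, n ≤ a → AgreeUp φ f (a - n) b := by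
    intro n
    induction n with
    | zero => simpa using h
    | succ n ih =>
      intro hn
      have := (ih (by omega)).left hφ hf h0 (by omega) (by omega)
      convert this using 1
      push_cast
      ring
  have col : ∀ n : ℕ, n ≤ b → AgreeUp φ f i (b - n) := by
    intro n
    induction n with
    | zero =>
      intro _
      have := row (a - i).toNat (by omega)
      convert this using 1 <;> omega
    | succ n ih =>
      intro hn
      have := (ih (by omega)).below hφ hf h0 (by omega) (by omega)
      convert this using 1
      push_cast
      ring
  have := col (b - j).toNat (by omega)
  convert this using 1
  omega

/-- The triangles reached by `AgreeUp.hull` cover `[0, a + 1] × [0, b + 1]` except the corner `(a +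
1, b + 1)`. This lemma and the next record the two maximal rectangles inside that region. -/
theorem AgreeUp.agreeOn_top {a b : ℤ} (ha : 0 ≤ a) (hb : 0 ≤ b) (h : AgreeUp φ f a b) :
    AgreeOn φ f 0 a 0 (b + 1) := by
  lift a to ℕ using ha
  lift b to ℕ using hb
  intro i j h1 h2 h3 h4
  rcases eq_or_lt_of_le h4 with rfl | h4
  · exact (h.hull hφ hf h0 h1 (Int.natCast_nonneg b) h2 le_rfl).2.2
  · exact (h.hull hφ hf h0 h1 h3 h2 (by omega)).1

theorem AgreeUp.agreeOn_right {a b : ℤ} (ha : 0 ≤ a) (hb : 0 ≤ b) (h : AgreeUp φ f a b) :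
    AgreeOn φ f 0 (a + 1) 0 b := by
  lift a to ℕ using ha
  lift b to ℕ using hb
  intro i j h1 h2 h3 h4
  rcases eq_or_lt_of_le h2 with rfl | h2
  · exact (h.hull hφ hf h0 (Int.natCast_nonneg a) h3 le_rfl h4).2.1
  · exact (h.hull hφ hf h0 h1 h3 (by omega) h4).1

/-- Agreement on the corner triangle of a rectangle implies agreement on the rectangle. -/
theorem agreeOn_of_corner {a b : ℤ} (ha : 1 ≤ a) (hb : 1 ≤ b) (h1 : φ (a, b) = f (a, b))
    (h2 : φ (a - 1, b) = f (a - 1, b)) (h3 : φ (a, b - 1) = f (a, b - 1)) :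
    AgreeOn φ f 0 a 0 b := by
  -- The corner triangle points downwards; convexity towards the origin adds the vertex which turns
  -- it into an `AgreeUp` triangle.
  have e := convex_antidiag hφ hf (i := a - 1) (j := b - 1) h0 (by simpa using h3)
    (by simpa using h2) (by omega)
  have hu : AgreeUp φ f (a - 1) (b - 1) := ⟨e, by simpa using h3, by simpa using h2⟩
  intro i j h4 h5 h6 h7
  by_cases hi : i = a
  · by_cases hj : j = b
    · rw [hi, hj, h1]
    · exact hu.agreeOn_right hφ hf h0 (by omega) (by omega) i j h4 (by omega) h6 (by omega)
  · exact hu.agreeOn_top hφ hf h0 (by omega) (by omega) i j h4 (by omega) h6 (by omega)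

end

/-- A chart can be extended above the rectangle `[0, a] × [0, b]` along a flat with which it
agrees near the upper right corner. -/
theorem exists_chart_top {φ f : ℤ × ℤ ↪ V} (hφ : B.IsOrientedChart φ) (hf : B.IsFlat f)
    {k a b : ℤ} (hk : 0 ≤ k) (hka : k < a) (hb : 1 ≤ b) (h : AgreeOn φ f k a b b)
    (h' : φ (a, b - 1) = f (a, b - 1)) :
    ∃ ψ : ℤ × ℤ ↪ V, B.IsOrientedChart ψ ∧ AgreeOn ψ φ 0 a 0 b ∧
      AgreeOn ψ f k a (b + 1) (b + 1) := by
  have e1 : φ (a, b) = f (a, b) := h _ _ (by omega) le_rfl le_rfl le_rfl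
  have e2 : φ (a - 1, b) = f (a - 1, b) := h _ _ (by omega) (by omega) le_rfl le_rfl
  have t1 := hf.1 _ (isFrame_std.near_mem (a - 1, b))
  -- Two chambers of `f` are placed above the last edge of the top row. Agreement at `(a, b - 1)`
  -- guarantees that the first of them does not fold back onto the chart.
  obtain ⟨φ₁, hφ₁, c0, c1, c2, c3, c4⟩ := exists_extension_above hφ t1 (i := a - 1) (j := b)
    (z := f (a - 1, b + 1)) (by simp) (by simp [e2]) (by simp [e1]) (by omega) (by simp [h'])
    (by simp [e2]) (by simp [e1])
  simp only [sub_add_cancel] at c1 c3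
  have r1 : AgreeOn φ₁ φ 0 a 0 b :=
    agreeOn_of_corner hφ₁ hφ.isFlat c0 (by omega) hb c3 c2 c1
  have t2 := hf.1 _ (isFrame_std.far_mem (a - 1, b))
  obtain ⟨φ₂, hφ₂, d0, d1, d2, d3, d4⟩ := exists_extension_antidiag hφ₁ t2 (i := a - 1) (j := b)
    (z := f (a, b + 1)) (by simp) (by simp [e1, c3]) (by simp [c4]) (by omega) (by simp [e2, c2])
    (by simp [e1, c3]) (by simp [c4]; omega)
  simp only [sub_add_cancel] at d2 d4
  have r2 : AgreeOn φ₂ φ 0 a 0 b := by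
    have hu : AgreeUp φ₂ φ₁ (a - 1) b := ⟨d1, by simpa using d2, d3⟩
    have := hu.agreeOn_right hφ₂ hφ₁.isFlat d0 (by omega) (by omega)
    rw [sub_add_cancel] at this
    exact this.trans r1
  -- The rest of the new row is forced: convexity runs leftwards, with a point of row `b` as the
  -- reference each time.
  have key : ∀ n : ℕ, k ≤ a - n → φ₂ (a - n, b + 1) = f (a - n, b + 1) := by
    intro n
    induction n with
    | zero => simp [d4]
    | succ n ih =>
      intro hn
      push_cast at hn
      have := ih (by omega)
      have v : φ₂ (a - n - 1, b) = f (a - n - 1, b) :=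
        (r2 _ _ (by omega) (by omega) (by omega) le_rfl).trans
          (h _ _ (by omega) (by omega) le_rfl le_rfl)
      have w : φ₂ (a - n, b) = f (a - n, b) :=
        (r2 _ _ (by omega) (by omega) (by omega) le_rfl).trans
          (h _ _ (by omega) (by omega) le_rfl le_rfl)
      have := convex_left hφ₂ hf v w this (by omega)
      convert this using 3 <;> push_cast <;> ring
  refine ⟨φ₂, hφ₂, r2, fun i j h1 h2 h3 h4 => ?_⟩
  obtain rfl : j = b + 1 := by omega
  have := key (a - i).toNat (by omega)
  convert this using 3 <;> omega

/-- A chart can be extended to the right of the rectangle `[0, a] × [0, b]` along a flat with which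
it agrees near the upper right corner. -/
theorem exists_chart_right {φ f : ℤ × ℤ ↪ V} (hφ : B.IsOrientedChart φ) (hf : B.IsFlat f)
    {l a b : ℤ} (hl : 0 ≤ l) (hlb : l < b) (ha : 1 ≤ a) (h : AgreeOn φ f a a l b)
    (h' : φ (a - 1, b) = f (a - 1, b)) :
    ∃ ψ : ℤ × ℤ ↪ V, B.IsOrientedChart ψ ∧ AgreeOn ψ φ 0 a 0 b ∧
      AgreeOn ψ f (a + 1) (a + 1) l b := by
  have e1 : φ (a, b) = f (a, b) := h _ _ le_rfl le_rfl (by omega) le_rfl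
  have e2 : φ (a, b - 1) = f (a, b - 1) := h _ _ le_rfl le_rfl (by omega) (by omega)
  have t1 := hf.1 _ (isFrame_std.near_mem (a, b - 1))
  obtain ⟨φ₁, hφ₁, c0, c1, c2, c3, c4⟩ := exists_extension_right hφ t1 (i := a) (j := b - 1)
    (z := f (a + 1, b - 1)) (by simp) (by simp [e2]) (by simp [e1]) (by omega) (by simp [h'])
    (by simp [e2]) (by simp [e1])
  simp only [sub_add_cancel] at c1 c3
  have r1 : AgreeOn φ₁ φ 0 a 0 b :=
    agreeOn_of_corner hφ₁ hφ.isFlat c0 ha (by omega) c3 c1 c2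
  have t2 := hf.1 _ (isFrame_std.far_mem (a, b - 1))
  obtain ⟨φ₂, hφ₂, d0, d1, d2, d3, d4⟩ := exists_extension_antidiag hφ₁ t2 (i := a) (j := b - 1)
    (z := f (a + 1, b)) (by simp) (by simp [c4]) (by simp [e1, c3]) (by omega) (by simp [e2, c2])
    (by simp [c4]; omega) (by simp [e1, c3])
  simp only [sub_add_cancel] at d3 d4
  have r2 : AgreeOn φ₂ φ 0 a 0 b := by
    have hu : AgreeUp φ₂ φ₁ a (b - 1) := ⟨d1, d2, by simpa using d3⟩
    have := hu.agreeOn_top hφ₂ hφ₁.isFlat d0 (by omega) (by omega)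
    rw [sub_add_cancel] at this
    exact this.trans r1
  have key : ∀ n : ℕ, l ≤ b - n → φ₂ (a + 1, b - n) = f (a + 1, b - n) := by
    intro n
    induction n with
    | zero => simp [d4]
    | succ n ih =>
      intro hn
      push_cast at hn
      have := ih (by omega)
      have v : φ₂ (a, b - n - 1) = f (a, b - n - 1) :=
        (r2 _ _ (by omega) le_rfl (by omega) (by omega)).trans
          (h _ _ le_rfl le_rfl (by omega) (by omega))
      have w : φ₂ (a, b - n) = f (a, b - n) :=
        (r2 _ _ (by omega) le_rfl (by omega) (by omega)).trans
          (h _ _ le_rfl le_rfl (by omega) (by omega))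
      have := convex_below hφ₂ hf v w this (by omega)
      convert this using 3 <;> push_cast <;> ring
  refine ⟨φ₂, hφ₂, r2, fun i j h1 h2 h3 h4 => ?_⟩
  obtain rfl : i = a + 1 := by omega
  have := key (b - j).toNat (by omega)
  convert this using 3 <;> omega

/-- On every rectangle a flat agrees with a chart of an apartment. -/
theorem IsFlat.exists_chart {f : ℤ × ℤ ↪ V} (hf : B.IsFlat f) (m n : ℕ) :
    ∃ φ : ℤ × ℤ ↪ V, B.IsOrientedChart φ ∧ AgreeOn φ f 0 (m + 1) 0 (n + 1) := by
  induction m with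
  | zero =>
    induction n with
    | zero =>
      obtain ⟨φ, hφ, c0, c1, c2, -⟩ := exists_chart_through hf (hf.1 _ (singleton_mem_plane 0))
      obtain ⟨ψ, hψ, d0, -, d1, d2, d3⟩ := exists_extension_antidiag hφ
        (hf.1 _ (isFrame_std.far_mem (0, 0))) (i := 0) (j := 0) (z := f (1, 1)) (by simp)
        (by simp [c1]) (by simp [c2]) (by omega) (by simp [c0]) (by simp [c1]) (by simp [c2])
      refine ⟨ψ, hψ, fun i j h1 h2 h3 h4 => ?_⟩
      simp only [zero_add] at d1 d2 d3
      rw [c0] at d0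
      rw [c1] at d1
      rw [c2] at d2
      obtain rfl | rfl : i = 0 ∨ i = 1 := by push_cast at h2; omega
      all_goals obtain rfl | rfl : j = 0 ∨ j = 1 := by push_cast at h4; omega
      all_goals assumption
    | succ n ih =>
      obtain ⟨φ, hφ, h⟩ := ih
      obtain ⟨ψ, hψ, h1, h2⟩ := exists_chart_top hφ hf (k := 0) (a := (0 : ℕ) + 1) (b := n + 1)
        le_rfl (by simp) (by simp) (h.mono le_rfl le_rfl (by omega) le_rfl)
        (h _ _ (by simp) le_rfl (by simp) (by simp))
      refine ⟨ψ, hψ, fun i j g1 g2 g3 g4 => ?_⟩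
      rcases le_or_gt j (n + 1) with hj | hj
      · exact (h1.trans h) i j g1 g2 g3 hj
      · exact h2 i j g1 g2 (by omega) (by push_cast at g4; omega)
  | succ m ih =>
    obtain ⟨φ, hφ, h⟩ := ih
    obtain ⟨ψ, hψ, h1, h2⟩ := exists_chart_right hφ hf (l := 0) (a := m + 1) (b := n + 1)
      le_rfl (by omega) (by simp) (h.mono (by omega) le_rfl le_rfl le_rfl)
      (h _ _ (by simp) (by simp) (by omega) le_rfl)
    refine ⟨ψ, hψ, fun i j g1 g2 g3 g4 => ?_⟩
    rcases le_or_gt i (m + 1) with hi | hi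
    · exact (h1.trans h) i j g1 hi g3 g4
    · exact h2 i j (by omega) (by push_cast at g2; omega) g3 g4

/-! ### Tiles and letters in flats -/

/-- The translate `(k, l) ↦ f (i + k, j + l)` of a map of the plane. -/
def shift (f : ℤ × ℤ ↪ V) (i j : ℤ) : ℤ × ℤ ↪ V :=
  (Equiv.addLeft ((i, j) : ℤ × ℤ)).toEmbedding.trans f

@[simp] theorem shift_apply (f : ℤ × ℤ ↪ V) (i j k l : ℤ) :
    shift f i j (k, l) = f (i + k, j + l) := rfl

theorem shift_eq (f : ℤ × ℤ ↪ V) (i j : ℤ) :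
    shift f i j = (frameEquiv (i, j) _ _ isFrame_std).toEmbedding.trans f := by
  ext p
  obtain ⟨k, l⟩ := p
  simp [frameEquiv_apply]

theorem IsFlat.shift {f : ℤ × ℤ ↪ V} (hf : B.IsFlat f) (i j : ℤ) :
    B.IsFlat (shift f i j) := by
  rw [shift_eq]
  exact hf.comp_frame _ _

/-- The image of a flat under a type preserving automorphism is a flat. -/
theorem IsFlat.smul {f : ℤ × ℤ ↪ V} (hf : B.IsFlat f) {γ : Equiv.Perm V}
    (hγ : γ ∈ B.typePreservingAut) : B.IsFlat (f.trans γ.toEmbedding) := by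
  refine ⟨fun s hs => ?_, fun i j => ?_⟩
  · rw [← Finset.map_map]
    exact (hγ.1 _).2 (hf.1 s hs)
  · have h := hγ.2
    simp only [Function.Embedding.trans_apply, Equiv.coe_toEmbedding]
    rw [h, h]
    exact hf.2 i j

/-- The parallelogram of shape `(m, n)` at the origin of a flat. -/
def IsFlat.parallelogram {f : ℤ × ℤ ↪ V} (hf : B.IsFlat f) (m n : ℕ) : B.Parallelogram m n where
  vertex i j := f ((i : ℤ), (j : ℤ))
  exists_chart := by
    obtain ⟨φ, hφ, h⟩ := hf.exists_chart m n
    exact ⟨φ, hφ, fun i j => (h _ _ (by omega) (by omega) (by omega) (by omega)).symm⟩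

/-- The tile of a flat with initial vertex `(i, j)`. -/
def IsFlat.tile {f : ℤ × ℤ ↪ V} (hf : B.IsFlat f) (i j : ℤ) : B.Tile :=
  (hf.shift i j).parallelogram 2 2

variable (Γ : Subgroup (Equiv.Perm V))

/-- The letter which a flat has at the position `(i, j)`. -/
def IsFlat.letter {f : ℤ × ℤ ↪ V} (hf : B.IsFlat f) (i j : ℤ) : B.Alphabet Γ :=
  B.orbit Γ (hf.tile i j)

variable {Γ}

theorem IsFlat.letter_eq_iff {f g : ℤ × ℤ ↪ V} (hf : B.IsFlat f) (hg : B.IsFlat g)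
    {i j k l : ℤ} : hf.letter Γ i j = hg.letter Γ k l ↔
      ∃ γ ∈ Γ, AgreeOn (γ ∘ TriangleBuilding.shift f i j) (TriangleBuilding.shift g k l) 0 2 0 2 := by
  have e : hf.letter Γ i j = hg.letter Γ k l ↔
      ∃ γ ∈ Γ, ∀ a b, γ ((hf.tile i j).vertex a b) = (hg.tile k l).vertex a b := Quotient.eq
  rw [e]
  refine exists_congr fun γ => and_congr_right fun _ => ⟨fun h a b h1 h2 h3 h4 => ?_, fun h a b =>
    h a b (by omega) (by omega) (by omega) (by omega)⟩
  lift a to ℕ using h1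
  lift b to ℕ using h3
  exact h ⟨a, by omega⟩ ⟨b, by omega⟩

theorem IsFlat.letter_congr {f g : ℤ × ℤ ↪ V} (hf : B.IsFlat f) (hg : B.IsFlat g)
    {i j : ℤ} (h : AgreeOn f g i (i + 2) j (j + 2)) : hf.letter Γ i j = hg.letter Γ i j :=
  (hf.letter_eq_iff hg).2 ⟨1, Γ.one_mem, fun a b h1 h2 h3 h4 => by
    simp only [Function.comp_apply, shift_apply, Equiv.Perm.one_apply]
    exact h _ _ (by omega) (by omega) (by omega) (by omega)⟩

theorem M₁_letter {f : ℤ × ℤ ↪ V} (hf : B.IsFlat f) (i j : ℤ) :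
    B.M₁ Γ (hf.letter Γ (i + 1) j) (hf.letter Γ i j) = 1 := by
  refine if_pos ⟨hf.tile i j, hf.tile (i + 1) j, (hf.shift i j).parallelogram 3 2, rfl, rfl, ?_⟩
  intro a b
  refine ⟨rfl, ?_⟩
  simp only [IsFlat.tile, IsFlat.parallelogram, shift_apply, Fin.val_succ]
  congr 2
  push_cast
  ring

theorem M₂_letter {f : ℤ × ℤ ↪ V} (hf : B.IsFlat f) (i j : ℤ) :
    B.M₂ Γ (hf.letter Γ i (j + 1)) (hf.letter Γ i j) = 1 := by
  refine if_pos ⟨hf.tile i j, hf.tile i (j + 1), (hf.shift i j).parallelogram 2 3, rfl, rfl, ?_⟩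
  intro a b
  refine ⟨rfl, ?_⟩
  simp only [IsFlat.tile, IsFlat.parallelogram, shift_apply, Fin.val_succ]
  congr 2
  push_cast
  ring

theorem Parallelogram.ext_vertex {m n : ℕ} {π π' : B.Parallelogram m n}
    (h : ∀ i j, π.vertex i j = π'.vertex i j) : π = π' := by
  cases π
  cases π'
  congr
  ext i j
  exact h i j

theorem exists_chart_letter (a : B.Alphabet Γ) : ∃ (f : ℤ × ℤ ↪ V) (hf : B.IsOrientedChart f),
    a = hf.isFlat.letter Γ 0 0 := by
  obtain ⟨τ, rfl⟩ := Quotient.exists_rep a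
  obtain ⟨f, hf, h⟩ := τ.exists_chart
  refine ⟨f, hf, congrArg _ (Parallelogram.ext_vertex fun i j => ?_)⟩
  simp [IsFlat.tile, IsFlat.parallelogram, h]

theorem exists_chart_of_M₁ {a b : B.Alphabet Γ} (h : B.M₁ Γ b a = 1) :
    ∃ (f : ℤ × ℤ ↪ V) (hf : B.IsOrientedChart f),
      a = hf.isFlat.letter Γ 0 0 ∧ b = hf.isFlat.letter Γ 1 0 := by
  classical
  have h' : ∃ (τ₁ τ₂ : B.Tile) (π : B.Parallelogram 3 2),
      a = B.orbit Γ τ₁ ∧ b = B.orbit Γ τ₂ ∧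
        ∀ i j, τ₁.vertex i j = π.vertex i.castSucc j ∧ τ₂.vertex i j = π.vertex i.succ j := by
    by_contra h'
    exact zero_ne_one ((if_neg h').symm.trans h)
  obtain ⟨τ₁, τ₂, π, rfl, rfl, hτ⟩ := h'
  obtain ⟨f, hf, h⟩ := π.exists_chart
  refine ⟨f, hf, congrArg _ (Parallelogram.ext_vertex fun i j => ?_),
    congrArg _ (Parallelogram.ext_vertex fun i j => ?_)⟩
  · simp [IsFlat.tile, IsFlat.parallelogram, hτ, h]
  · simp [IsFlat.tile, IsFlat.parallelogram, hτ, h, add_comm]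

theorem exists_chart_of_M₂ {a b : B.Alphabet Γ} (h : B.M₂ Γ b a = 1) :
    ∃ (f : ℤ × ℤ ↪ V) (hf : B.IsOrientedChart f),
      a = hf.isFlat.letter Γ 0 0 ∧ b = hf.isFlat.letter Γ 0 1 := by
  classical
  have h' : ∃ (τ₁ τ₂ : B.Tile) (π : B.Parallelogram 2 3),
      a = B.orbit Γ τ₁ ∧ b = B.orbit Γ τ₂ ∧
        ∀ i j, τ₁.vertex i j = π.vertex i j.castSucc ∧ τ₂.vertex i j = π.vertex i j.succ := by
    by_contra h'
    exact zero_ne_one ((if_neg h').symm.trans h)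
  obtain ⟨τ₁, τ₂, π, rfl, rfl, hτ⟩ := h'
  obtain ⟨f, hf, h⟩ := π.exists_chart
  refine ⟨f, hf, congrArg _ (Parallelogram.ext_vertex fun i j => ?_),
    congrArg _ (Parallelogram.ext_vertex fun i j => ?_)⟩
  · simp [IsFlat.tile, IsFlat.parallelogram, hτ, h]
  · simp [IsFlat.tile, IsFlat.parallelogram, hτ, h, add_comm]

/-! ### Moving flats by elements of the group -/

section Group

variable (hΓ : Γ ≤ B.typePreservingAut)

include hΓ

/-- The image of a flat under a translation of the plane and an element of `Γ`. -/
theorem exists_translate {g : ℤ × ℤ ↪ V} (hg : B.IsFlat g) {γ : Equiv.Perm V} (hγ : γ ∈ Γ)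
    (i j k l : ℤ) : ∃ (g' : ℤ × ℤ ↪ V) (hg' : B.IsFlat g'),
      (∀ r s, g' (i + r, j + s) = γ (g (k + r, l + s))) ∧
      ∀ r s, hg'.letter Γ (i + r) (j + s) = hg.letter Γ (k + r) (l + s) := by
  have hg' := (hg.shift (k - i) (l - j)).smul (hΓ hγ)
  have e : ∀ r s, ((shift g (k - i) (l - j)).trans γ.toEmbedding) (i + r, j + s) =
      γ (g (k + r, l + s)) := by
    intro r s
    simp only [Function.Embedding.trans_apply, shift_apply, Equiv.coe_toEmbedding]
    congr 3 <;> ring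
  refine ⟨_, hg', e, fun r s => ?_⟩
  refine ((hg.letter_eq_iff hg').2 ⟨γ, hγ, fun a b _ _ _ _ => ?_⟩).symm
  simp only [Function.comp_apply, shift_apply]
  rw [add_assoc, add_assoc, add_assoc, add_assoc, e]

/-- Equal letters mean that an element of `Γ` carries one tile to the other; applying it to the
whole flat and translating the parameters makes the tiles coincide and leaves all letters unchanged.
-/
theorem exists_move {f g : ℤ × ℤ ↪ V} (hf : B.IsFlat f) (hg : B.IsFlat g)
    {i j k l : ℤ} (h : hf.letter Γ i j = hg.letter Γ k l) :
    ∃ (g' : ℤ × ℤ ↪ V) (hg' : B.IsFlat g'), AgreeOn g' f i (i + 2) j (j + 2) ∧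
      ∀ r s, hg'.letter Γ (i + r) (j + s) = hg.letter Γ (k + r) (l + s) := by
  obtain ⟨γ, hγ, h⟩ := (hg.letter_eq_iff hf).1 h.symm
  obtain ⟨g', hg', e, e'⟩ := exists_translate hΓ hg hγ i j k l
  refine ⟨g', hg', fun a b h1 h2 h3 h4 => ?_, e'⟩
  have e1 := e (a - i) (b - j)
  have e2 := h (a - i) (b - j) (by omega) (by omega) (by omega) (by omega)
  simp only [Function.comp_apply, shift_apply] at e2
  rw [e2] at e1
  simpa using e1

omit hΓ in
theorem map_near_mem_chambers {f : ℤ × ℤ ↪ V} (hf : B.IsFlat f) (x : ℤ × ℤ) {u w : ℤ × ℤ}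
    (h : IsFrame u w) : Finset.map f {x, x + u, x + w} ∈ B.chambers := by
  refine ⟨hf.1 _ (h.near_mem x), ?_⟩
  rw [Finset.card_map, Finset.card_eq_three]
  exact ⟨_, _, _, (h.adj₁ x).ne, (h.adj₂ x).ne, (h.adj₃ x).ne, rfl⟩

variable (hreg : B.ActsRegularlyOnChambers Γ)

include hreg

omit hΓ in
theorem eq_one_of_fixes {f : ℤ × ℤ ↪ V} (hf : B.IsFlat f) {γ : Equiv.Perm V} (hγ : γ ∈ Γ)
    {i j : ℤ} (h : AgreeUp (γ ∘ f) f i j) : γ = 1 := by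
  have hc := map_near_mem_chambers hf (i, j) isFrame_std
  refine (hreg _ hc _ hc).unique ⟨hγ, ?_⟩ ⟨Γ.one_mem, Finset.map_refl⟩
  classical
  obtain ⟨h1, h2, h3⟩ := h
  simp only [Function.comp_apply] at h1 h2 h3
  simp [h1, h2, h3]

omit hΓ in
/-- Flats with the same letter which agree on a chamber of the tile agree on the tile. -/
theorem agreeOn_of_letter_eq {f g : ℤ × ℤ ↪ V} (hf : B.IsFlat f) (hg : B.IsFlat g) {i j a b : ℤ}
    (h : hf.letter Γ i j = hg.letter Γ i j) (hab : AgreeUp f g a b) (h1 : i ≤ a) (h2 : a ≤ i + 1)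
    (h3 : j ≤ b) (h4 : b ≤ j + 1) : AgreeOn f g i (i + 2) j (j + 2) := by
  obtain ⟨γ, hγ, h⟩ := (hf.letter_eq_iff hg).1 h
  have e : AgreeOn (γ ∘ f) g i (i + 2) j (j + 2) := by
    intro k l g1 g2 g3 g4
    have := h (k - i) (l - j) (by omega) (by omega) (by omega) (by omega)
    simpa using this
  -- The element which carries one tile to the other fixes the common chamber pointwise, hence is
  -- trivial by freeness.
  have : AgreeUp (γ ∘ f) f a b := by
    obtain ⟨e1, e2, e3⟩ := e.agreeUp h1 (by omega) h3 (by omega)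
    obtain ⟨c1, c2, c3⟩ := hab
    exact ⟨e1.trans c1.symm, e2.trans c2.symm, e3.trans c3.symm⟩
  obtain rfl := eq_one_of_fixes hreg hf hγ this
  exact e

/-- Transitivity matches the two chambers as sets; since `Γ` preserves types and a chamber has one
vertex of each type, matching one pair of corresponding types matches the vertices. -/
theorem exists_move_triangle {f g : ℤ × ℤ ↪ V} (hf : B.IsFlat f) (hg : B.IsFlat g)
    {i j k l : ℤ} (h : B.type (f (i, j)) = B.type (g (k, l))) :
    ∃ (g' : ℤ × ℤ ↪ V) (hg' : B.IsFlat g'), AgreeUp f g' i j ∧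
      hg'.letter Γ i j = hg.letter Γ k l := by
  have hc := map_near_mem_chambers hg (k, l) isFrame_std
  have hd := map_near_mem_chambers hf (i, j) isFrame_std
  obtain ⟨γ, ⟨hγ, h1⟩, -⟩ := hreg _ hc _ hd
  obtain ⟨g', hg', e, e'⟩ := exists_translate hΓ hg hγ i j k l
  have tf := hf.2
  have tg := hg'.2
  have t0 : B.type (f (i, j)) = B.type (g' (i, j)) := by
    have e0 := e 0 0
    simp only [add_zero] at e0
    rw [e0, (hΓ hγ).2, h]
  have key : ∀ r s, (r, s) ∈ ({(0, 0), (1, 0), (0, 1)} : Finset (ℤ × ℤ)) →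
      f (i + r, j + s) = g' (i + r, j + s) := by
    intro r s hrs
    refine B.type_injOn _ hd.1 ?_ ?_ ?_
    · simp only [Finset.mem_insert, Finset.mem_singleton, Prod.mk.injEq] at hrs
      rcases hrs with ⟨rfl, rfl⟩ | ⟨rfl, rfl⟩ | ⟨rfl, rfl⟩ <;> simp
    · rw [e, ← h1, Finset.mem_coe, ← Equiv.coe_toEmbedding, Finset.mem_map']
      simp only [Finset.mem_insert, Finset.mem_singleton, Prod.mk.injEq] at hrs
      rcases hrs with ⟨rfl, rfl⟩ | ⟨rfl, rfl⟩ | ⟨rfl, rfl⟩ <;> simp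
    · rw [tf i, tg i] at t0
      rw [tf, tg]
      push_cast
      linear_combination t0
  refine ⟨g', hg', ⟨?_, ?_, ?_⟩, ?_⟩
  · simpa using key 0 0 (by simp)
  · simpa using key 1 0 (by simp)
  · simpa using key 0 1 (by simp)
  · simpa using e' 0 0

/-! ### Completion of squares of letters -/

/-- Existence: realise `a, b` by a chart on `[0, 3] × [0, 2]`, move a flat realising `b, c` onto the
tile of `b`, and add its top row; the corner `(0, 3)` then comes from the apartment. Uniqueness: the
tiles of `a` and of any candidate `d` share a `2 × 1` strip, which contains a chamber of the tile of
`c`. That chamber and the letter fix the tile of `c`, and convexity fixes `(0, 3)`. -/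
theorem existsUnique_square₁ {a b c : B.Alphabet Γ} (hab : B.M₁ Γ b a = 1)
    (hbc : B.M₂ Γ c b = 1) : ∃! d, B.M₂ Γ d a = 1 ∧ B.M₁ Γ c d = 1 := by
  obtain ⟨f, hf, rfl, rfl⟩ := exists_chart_of_M₁ hab
  obtain ⟨g, hg, hb, rfl⟩ := exists_chart_of_M₂ hbc
  obtain ⟨g', hg', h1, h2⟩ := exists_move hΓ hf.isFlat hg.isFlat hb
  obtain ⟨ψ, hψ, h3, h4⟩ := exists_chart_top hf hg' (k := 1) (a := 3) (b := 2) (by omega)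
    (by omega) (by omega) (h1.symm.mono le_rfl le_rfl (by omega) le_rfl)
    (h1.symm _ _ (by omega) le_rfl (by omega) (by omega))
  have hψf := hψ.isFlat
  have ea : hψf.letter Γ 0 0 = hf.isFlat.letter Γ 0 0 :=
    hψf.letter_congr _ (h3.mono le_rfl (by omega) le_rfl (by omega))
  have ec : hψf.letter Γ 1 1 = hg.isFlat.letter Γ 0 1 := by
    have := h2 0 1
    simp only [add_zero, zero_add] at this
    rw [← this]
    refine hψf.letter_congr hg' fun i j g1 g2 g3 g4 => ?_
    rcases le_or_gt j 2 with hj | hj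
    · exact (h3 i j (by omega) (by omega) (by omega) hj).trans
        (h1 i j (by omega) (by omega) (by omega) (by omega)).symm
    · exact h4 i j (by omega) (by omega) (by omega) (by omega)
  rw [← ea, ← ec]
  refine ⟨hψf.letter Γ 0 1, ⟨M₂_letter hψf 0 0, M₁_letter hψf 0 1⟩, ?_⟩
  rintro d ⟨hd1, hd2⟩
  obtain ⟨α, hα, hα0, rfl⟩ := exists_chart_of_M₂ hd1
  obtain ⟨β, hβ, hβ0, hβ1⟩ := exists_chart_of_M₁ hd2
  obtain ⟨α', hα', k1, k2⟩ := exists_move hΓ hψf hα.isFlat hα0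
  have kd := k2 0 1
  simp only [add_zero, zero_add] at kd
  rw [← kd] at hβ0 ⊢
  obtain ⟨β', hβ', l1, l2⟩ := exists_move hΓ hα' hβ.isFlat hβ0
  have l3 := l2 1 0
  simp only [add_zero, zero_add] at l3
  rw [← l3] at hβ1
  -- The strip common to the tiles at `(0, 0)` and `(0, 1)`; its triangle at `(1, 1)` also belongs
  -- to the tile at `(1, 1)`.
  have m1 : AgreeOn ψ β' 0 2 1 2 := fun i j g1 g2 g3 g4 =>
    (k1 i j g1 (by omega) (by omega) (by omega)).symm.trans
      (l1 i j g1 (by omega) g3 (by omega)).symm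
  have m2 := agreeOn_of_letter_eq hreg hψf hβ' hβ1 (a := 1) (b := 1)
    (m1.agreeUp (by omega) (by omega) (by omega) (by omega)) le_rfl (by omega) le_rfl (by omega)
  have m3 := convex_left hψ hβ' (m1 0 2 (by omega) (by omega) (by omega) (by omega))
    (i := 1) (j := 2) (m1 1 2 (by omega) (by omega) (by omega) (by omega))
    (m2 1 3 (by omega) (by omega) (by omega) (by omega)) (by omega)
  refine (hα'.letter_congr hβ' ?_).trans (hψf.letter_congr hβ' ?_).symm
  · exact l1.symm
  · intro i j g1 g2 g3 g4
    rcases le_or_gt j 2 with hj | hj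
    · exact m1 i j g1 g2 g3 hj
    · obtain rfl : j = 3 := by omega
      rcases eq_or_lt_of_le g1 with rfl | g1
      · exact m3
      · exact m2 i 3 (by omega) (by omega) (by omega) (by omega)

/-- The mirror image of `existsUnique_square₁`, with `exists_chart_right` and `convex_below` and the
corner `(3, 0)`. -/
theorem existsUnique_square₂ {a b c : B.Alphabet Γ} (hab : B.M₂ Γ b a = 1)
    (hbc : B.M₁ Γ c b = 1) : ∃! d, B.M₁ Γ d a = 1 ∧ B.M₂ Γ c d = 1 := by
  obtain ⟨f, hf, rfl, rfl⟩ := exists_chart_of_M₂ hab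
  obtain ⟨g, hg, hb, rfl⟩ := exists_chart_of_M₁ hbc
  obtain ⟨g', hg', h1, h2⟩ := exists_move hΓ hf.isFlat hg.isFlat hb
  obtain ⟨ψ, hψ, h3, h4⟩ := exists_chart_right hf hg' (l := 1) (a := 2) (b := 3) (by omega)
    (by omega) (by omega) (h1.symm.mono (by omega) le_rfl le_rfl le_rfl)
    (h1.symm _ _ (by omega) (by omega) (by omega) (by omega))
  have hψf := hψ.isFlat
  have ea : hψf.letter Γ 0 0 = hf.isFlat.letter Γ 0 0 :=
    hψf.letter_congr _ (h3.mono le_rfl (by omega) le_rfl (by omega))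
  have ec : hψf.letter Γ 1 1 = hg.isFlat.letter Γ 1 0 := by
    have := h2 1 0
    simp only [add_zero, zero_add] at this
    rw [← this]
    refine hψf.letter_congr hg' fun i j g1 g2 g3 g4 => ?_
    rcases le_or_gt i 2 with hi | hi
    · exact (h3 i j (by omega) (by omega) (by omega) (by omega)).trans
        (h1 i j (by omega) (by omega) (by omega) (by omega)).symm
    · exact h4 i j (by omega) (by omega) (by omega) (by omega)
  rw [← ea, ← ec]
  refine ⟨hψf.letter Γ 1 0, ⟨M₁_letter hψf 0 0, M₂_letter hψf 1 0⟩, ?_⟩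
  rintro d ⟨hd1, hd2⟩
  obtain ⟨α, hα, hα0, rfl⟩ := exists_chart_of_M₁ hd1
  obtain ⟨β, hβ, hβ0, hβ1⟩ := exists_chart_of_M₂ hd2
  obtain ⟨α', hα', k1, k2⟩ := exists_move hΓ hψf hα.isFlat hα0
  have kd := k2 1 0
  simp only [add_zero, zero_add] at kd
  rw [← kd] at hβ0 ⊢
  obtain ⟨β', hβ', l1, l2⟩ := exists_move hΓ hα' hβ.isFlat hβ0
  have l3 := l2 0 1
  simp only [add_zero, zero_add] at l3
  rw [← l3] at hβ1
  have m1 : AgreeOn ψ β' 1 2 0 2 := fun i j g1 g2 g3 g4 =>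
    (k1 i j (by omega) (by omega) (by omega) (by omega)).symm.trans
      (l1 i j g1 (by omega) g3 (by omega)).symm
  have m2 := agreeOn_of_letter_eq hreg hψf hβ' hβ1 (a := 1) (b := 1)
    (m1.agreeUp (by omega) (by omega) (by omega) (by omega)) le_rfl (by omega) le_rfl (by omega)
  have m3 := convex_below hψ hβ' (m1 2 0 (by omega) (by omega) (by omega) (by omega))
    (i := 2) (j := 1) (m1 2 1 (by omega) (by omega) (by omega) (by omega))
    (m2 3 1 (by omega) (by omega) (by omega) (by omega)) (by omega)
  refine (hα'.letter_congr hβ' ?_).trans (hψf.letter_congr hβ' ?_).symm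
  · exact l1.symm
  · intro i j g1 g2 g3 g4
    rcases le_or_gt i 2 with hi | hi
    · exact m1 i j g1 hi g3 g4
    · obtain rfl : i = 3 := by omega
      rcases eq_or_lt_of_le g3 with rfl | g3
      · exact m3
      · exact m2 3 j (by omega) (by omega) (by omega) (by omega)

end Group

end TriangleBuilding

namespace RankTwo

variable {A : Type*}

/-! ### Grids and products of words -/

/-- The restriction of `f` to `[0, m] × [0, n]` has horizontal steps in `P` and vertical steps
in `Q`. -/
def IsGrid (P Q : A → A → Prop) (m n : ℕ) (f : ℕ → ℕ → A) : Prop :=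
  (∀ i j, i < m → j ≤ n → P (f i j) (f (i + 1) j)) ∧
    ∀ i j, i ≤ m → j < n → Q (f i j) (f i (j + 1))

theorem IsGrid.swap {P Q : A → A → Prop} {m n : ℕ} {f : ℕ → ℕ → A} (h : IsGrid P Q m n f) :
    IsGrid Q P n m (fun i j => f j i) :=
  ⟨fun i j hi hj => h.2 j i hj hi, fun i j hi hj => h.1 j i hj hi⟩

theorem IsGrid.translate {P Q : A → A → Prop} {m n r s : ℕ} {f : ℕ → ℕ → A}
    (h : IsGrid P Q (m + r) (n + s) f) : IsGrid P Q r s (fun i j => f (m + i) (n + j)) :=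
  ⟨fun i j hi hj => h.1 (m + i) (n + j) (by omega) (by omega),
    fun i j hi hj => h.2 (m + i) (n + j) (by omega) (by omega)⟩

theorem IsGrid.mono {P Q : A → A → Prop} {m n m' n' : ℕ} {f : ℕ → ℕ → A}
    (h : IsGrid P Q m n f) (hm : m' ≤ m) (hn : n' ≤ n) : IsGrid P Q m' n' f :=
  ⟨fun i j hi hj => h.1 i j (by omega) (by omega), fun i j hi hj => h.2 i j (by omega) (by omega)⟩

/-- A vertical step followed by a horizontal step can be completed to a unique square. -/
def SquareProperty (P Q : A → A → Prop) : Prop :=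
  ∀ a b c, Q a b → P b c → ∃! d, P a d ∧ Q d c

variable {P Q : A → A → Prop}

/-- The new column starts from `c` at the top and is filled downwards, one square at a time. -/
theorem SquareProperty.exists_column (h : SquareProperty P Q) (n : ℕ) {x : ℕ → A} {c : A}
    (hx : ∀ j < n, Q (x j) (x (j + 1))) (hc : P (x n) c) :
    ∃ z : ℕ → A, z n = c ∧ (∀ j < n, Q (z j) (z (j + 1))) ∧ ∀ j ≤ n, P (x j) (z j) := by
  induction n generalizing c with
  | zero =>
    refine ⟨fun _ => c, rfl, fun j hj => by omega, fun j hj => ?_⟩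
    obtain rfl : j = 0 := by omega
    exact hc
  | succ n ih =>
    obtain ⟨d, ⟨hd1, hd2⟩, -⟩ := h _ _ _ (hx n (by omega)) hc
    obtain ⟨z, rfl, hz2, hz3⟩ := ih (fun j hj => hx j (by omega)) hd1
    refine ⟨fun j => if j = n + 1 then c else z j, by simp, fun j hj => ?_, fun j hj => ?_⟩
    · by_cases hjn : j = n
      · subst hjn
        simpa using hd2
      · have h1 : j ≠ n + 1 := by omega
        simpa [hjn, h1] using hz2 j (by omega)
    · by_cases hjn : j = n + 1
      · subst hjn
        simpa using hc
      · simpa [hjn] using hz3 j (by omega)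

/-- The prescribed letters `y` continue the top row; below each of them a column is filled in. -/
theorem SquareProperty.exists_extension (h : SquareProperty P Q) {m n : ℕ} (r : ℕ)
    {f : ℕ → ℕ → A} {y : ℕ → A} (hf : IsGrid P Q m n f) (h0 : y 0 = f m n)
    (hy : ∀ i < r, P (y i) (y (i + 1))) : ∃ g, IsGrid P Q (m + r) n g ∧
      (∀ i j, i ≤ m → j ≤ n → g i j = f i j) ∧ ∀ i ≤ r, g (m + i) n = y i := by
  induction r with
  | zero =>
    refine ⟨f, hf, fun _ _ _ _ => rfl, fun i hi => ?_⟩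
    obtain rfl : i = 0 := by omega
    exact h0.symm
  | succ r ih =>
    obtain ⟨g, hg, h1, h2⟩ := ih fun i hi => hy i (by omega)
    obtain ⟨z, hz, hz1, hz2⟩ := h.exists_column n (x := g (m + r)) (c := y (r + 1))
      (fun j hj => hg.2 (m + r) j le_rfl hj) (by rw [h2 r le_rfl]; exact hy r (by omega))
    refine ⟨fun i j => if i = m + r + 1 then z j else g i j, ⟨fun i j hi hj => ?_, fun i j hi hj =>
      ?_⟩, fun i j hi hj => ?_, fun i hi => ?_⟩
    · by_cases hir : i = m + r
      · subst hir
        simpa using hz2 j hj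
      · have h1 : i ≠ m + r + 1 := by omega
        simpa [hir, h1] using hg.1 i j (by omega) hj
    · by_cases hir : i = m + r + 1
      · simpa [hir] using hz1 j hj
      · simpa [hir] using hg.2 i j (by omega) hj
    · have : i ≠ m + r + 1 := by omega
      simpa [this] using h1 i j hi hj
    · by_cases hir : i = r + 1
      · subst hir
        simpa [add_assoc] using hz
      · have : m + i ≠ m + r + 1 := by omega
        simpa [this] using h2 i (by omega)

/-- A grid is determined by its left column and its top row. -/
theorem SquareProperty.grid_ext (h : SquareProperty P Q) {m n : ℕ} {f g : ℕ → ℕ → A}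
    (hf : IsGrid P Q m n f) (hg : IsGrid P Q m n g) (hl : ∀ j ≤ n, f 0 j = g 0 j)
    (ht : ∀ i ≤ m, f i n = g i n) : ∀ i ≤ m, ∀ j ≤ n, f i j = g i j := by
  intro i
  induction i with
  | zero => exact fun _ => hl
  | succ i ih =>
    intro hi
    have key : ∀ k ≤ n, f (i + 1) (n - k) = g (i + 1) (n - k) := by
      intro k
      induction k with
      | zero => exact fun _ => ht _ hi
      | succ k ihk =>
        intro hk
        have e : n - (k + 1) + 1 = n - k := by omega
        have f1 := hf.2 i (n - (k + 1)) (by omega) (by omega)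
        have f2 := hf.1 i (n - k) (by omega) (by omega)
        have f3 := hf.1 i (n - (k + 1)) (by omega) (by omega)
        have f4 := hf.2 (i + 1) (n - (k + 1)) (by omega) (by omega)
        have g3 := hg.1 i (n - (k + 1)) (by omega) (by omega)
        have g4 := hg.2 (i + 1) (n - (k + 1)) (by omega) (by omega)
        rw [e] at f1 f4 g4
        rw [← ih (by omega) _ (by omega)] at g3
        rw [← ihk (by omega)] at g4
        exact (h _ _ _ f1 f2).unique ⟨f3, f4⟩ ⟨g3, g4⟩
    intro j hj
    have := key (n - j) (by omega)
    rwa [Nat.sub_sub_self hj] at this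

/-- A grid is determined by its bottom row and its right column. -/
theorem SquareProperty.grid_ext' (h : SquareProperty Q P) {m n : ℕ} {f g : ℕ → ℕ → A}
    (hf : IsGrid P Q m n f) (hg : IsGrid P Q m n g) (hb : ∀ i ≤ m, f i 0 = g i 0)
    (hr : ∀ j ≤ n, f m j = g m j) : ∀ i ≤ m, ∀ j ≤ n, f i j = g i j :=
  fun i hi j hj => h.grid_ext hf.swap hg.swap hb hr j hj i hi

/-- The bottom row of `v` extends `u` to the right, then the right column of `v` extends the result
upwards, the rows being filled leftwards. The upper right block shares its bottom row and right
column with `v`, hence equals `v`. -/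
theorem exists_grid_product (h : SquareProperty P Q) (h' : SquareProperty Q P) {m n r s : ℕ}
    {u v : ℕ → ℕ → A} (hu : IsGrid P Q m n u) (hv : IsGrid P Q r s v) (huv : u m n = v 0 0) :
    ∃ w, IsGrid P Q (m + r) (n + s) w ∧ (∀ i j, i ≤ m → j ≤ n → w i j = u i j) ∧
      ∀ i j, i ≤ r → j ≤ s → w (m + i) (n + j) = v i j := by
  obtain ⟨f, hf, hf1, hf2⟩ := h.exists_extension r hu (y := fun i => v i 0) huv.symm
    fun i hi => hv.1 i 0 hi (Nat.zero_le _)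
  obtain ⟨g, hg, hg1, hg2⟩ := h'.exists_extension s hf.swap (y := fun j => v r j)
    (hf2 r le_rfl).symm fun j hj => hv.2 r j le_rfl hj
  have hw : IsGrid P Q (m + r) (n + s) (fun i j => g j i) := hg.swap
  refine ⟨_, hw, fun i j hi hj => (hg1 j i hj (by omega)).trans (hf1 i j hi hj), ?_⟩
  intro i j hi hj
  refine h'.grid_ext' hw.translate hv (fun i hi => ?_) (fun j hj => ?_) i hi j hj
  · exact (hg1 n (m + i) le_rfl (by omega)).trans (hf2 i hi)
  · exact hg2 j hj

/-- The lower right block has its left column in `u` and its top row in `v`; after that the whole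
upper strip has a known bottom row and its right column in `v`. -/
theorem grid_product_unique (h : SquareProperty P Q) (h' : SquareProperty Q P) {m n r s : ℕ}
    {w w' : ℕ → ℕ → A} (hw : IsGrid P Q (m + r) (n + s) w) (hw' : IsGrid P Q (m + r) (n + s) w')
    (hu : ∀ i j, i ≤ m → j ≤ n → w i j = w' i j)
    (hv : ∀ i j, i ≤ r → j ≤ s → w (m + i) (n + j) = w' (m + i) (n + j)) :
    ∀ i ≤ m + r, ∀ j ≤ n + s, w i j = w' i j := by
  have hbr : ∀ i ≤ m + r, ∀ j ≤ n, w i j = w' i j := by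
    intro i hi j hj
    rcases le_total i m with him | him
    · exact hu i j him hj
    · have k := hw.mono le_rfl (Nat.le_add_right n s)
      have k' := hw'.mono le_rfl (Nat.le_add_right n s)
      have := h.grid_ext (IsGrid.translate (n := 0) (s := n) (by simpa using k))
        (IsGrid.translate (n := 0) (s := n) (by simpa using k'))
        (fun j hj => by simpa using hu m j le_rfl hj)
        (fun i hi => by simpa using hv i 0 hi (Nat.zero_le _)) (i - m) (by omega) j hj
      simpa [Nat.add_sub_cancel' him] using this
  intro i hi j hj
  rcases le_total j n with hjn | hjn
  · exact hbr i hi j hjn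
  · have := h'.grid_ext' (IsGrid.translate (m := 0) (r := m + r) (by simpa using hw))
        (IsGrid.translate (m := 0) (r := m + r) (by simpa using hw'))
        (fun i hi => by simpa using hbr i hi n le_rfl)
        (fun j hj => by simpa using hv r j le_rfl hj) i hi (j - n) (by omega)
    simpa [Nat.add_sub_cancel' hjn] using this

/-! ### Words as grids, and condition (H1) -/

variable {M₁ M₂ : Matrix A A ℤ}

/-- The extension of a word to a function on `ℕ × ℕ`. -/
def Word.extend {m n : ℕ} (w : Word M₁ M₂ m n) (i j : ℕ) : A :=
  -- Indices beyond the domain are clamped to the last row or column; only values inside the domain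
  -- are ever used.
  w.letter ⟨min i m, by omega⟩ ⟨min j n, by omega⟩

theorem Word.extend_eq {m n : ℕ} (w : Word M₁ M₂ m n) {i j : ℕ} (hi : i ≤ m) (hj : j ≤ n) :
    w.extend i j = w.letter ⟨i, by omega⟩ ⟨j, by omega⟩ := by
  simp [Word.extend, hi, hj]

theorem Word.isGrid {m n : ℕ} (w : Word M₁ M₂ m n) :
    IsGrid (fun a b => M₁ b a = 1) (fun a b => M₂ b a = 1) m n w.extend := by
  refine ⟨fun i j hi hj => ?_, fun i j hi hj => ?_⟩
  · rw [w.extend_eq hi.le hj, w.extend_eq hi hj]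
    exact w.step₁ ⟨i, hi⟩ ⟨j, by omega⟩
  · rw [w.extend_eq hi hj.le, w.extend_eq hi hj]
    exact w.step₂ ⟨i, by omega⟩ ⟨j, hj⟩

theorem Word.ext_letter {m n : ℕ} {w w' : Word M₁ M₂ m n}
    (h : ∀ i j, w.letter i j = w'.letter i j) : w = w' := by
  cases w
  cases w'
  congr
  ext i j
  exact h i j

/-- A grid of letters is a word. -/
def wordOfGrid {m n : ℕ} {f : ℕ → ℕ → A}
    (h : IsGrid (fun a b => M₁ b a = 1) (fun a b => M₂ b a = 1) m n f) : Word M₁ M₂ m n where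
  letter i j := f i j
  step₁ i j := h.1 i j (by omega) (by omega)
  step₂ i j := h.2 i j (by omega) (by omega)

/-- (H1) follows from the unique completion of squares. -/
theorem h1_of_squares
    (h : SquareProperty (fun a b => M₁ b a = 1) (fun a b => M₂ b a = 1))
    (h' : SquareProperty (fun a b => M₂ b a = 1) (fun a b => M₁ b a = 1)) : H1 M₁ M₂ := by
  intro m n r s u v huv
  obtain ⟨w, hw, hw1, hw2⟩ := exists_grid_product h h' u.isGrid v.isGrid (by
    rw [u.extend_eq le_rfl le_rfl, v.extend_eq (Nat.zero_le _) (Nat.zero_le _)]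
    exact huv)
  refine ⟨wordOfGrid hw, ⟨fun i j => ?_, fun i j => ?_⟩, fun w' hw' => ?_⟩
  · exact (hw1 i j (by omega) (by omega)).trans (u.extend_eq (by omega) (by omega))
  · exact (hw2 i j (by omega) (by omega)).trans (v.extend_eq (by omega) (by omega))
  · have := grid_product_unique h h' w'.isGrid hw (fun i j hi hj => ?_) (fun i j hi hj => ?_)
    · refine Word.ext_letter fun i j => ?_
      have := this i (by omega) j (by omega)
      rwa [w'.extend_eq (by omega) (by omega)] at this
    · rw [w'.extend_eq (by omega) (by omega), hw1 i j hi hj, u.extend_eq hi hj]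
      exact hw'.1 ⟨i, by omega⟩ ⟨j, by omega⟩
    · rw [w'.extend_eq (by omega) (by omega), hw2 i j hi hj, v.extend_eq hi hj]
      exact hw'.2 ⟨i, by omega⟩ ⟨j, by omega⟩

theorem Word.IsPeriodic.neg {m n : ℕ} {w : Word M₁ M₂ m n} {p : ℤ × ℤ} (h : w.IsPeriodic p) :
    w.IsPeriodic (-p) := by
  intro i i' j j' hi hj
  simp only [Prod.fst_neg, Prod.snd_neg] at hi hj
  exact (h i' i j' j (by omega) (by omega)).symm

end RankTwo

namespace TriangleBuilding

variable {V : Type*} {B : TriangleBuilding V}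

/-! ### Irreducibility -/

/-- A chart and a flat with a common chamber can be glued along it. -/
theorem exists_chart_glue {φ f : ℤ × ℤ ↪ V} (hφ : B.IsOrientedChart φ) (hf : B.IsFlat f) {r s : ℤ}
    (hr : 0 ≤ r) (hs : 0 ≤ s) (h : AgreeUp φ f r s) :
    ∃ ψ : ℤ × ℤ ↪ V, B.IsOrientedChart ψ ∧ AgreeOn ψ φ 0 r 0 (s + 1) ∧
      AgreeOn ψ φ 0 (r + 1) 0 s ∧ AgreeOn ψ f r (r + 2) s (s + 2) := by
  obtain ⟨h1, h2, h3⟩ := h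
  -- One chamber completes the common triangle to a unit square of `f`, which is what the extensions
  -- to the right and above need to start.
  obtain ⟨ψ₁, hψ₁, c0, c1, c2, c3, c4⟩ := exists_extension_antidiag hφ
    (hf.1 _ (isFrame_std.far_mem (r, s))) (i := r) (j := s) (z := f (r + 1, s + 1)) (by simp)
    (by simp [h2]) (by simp [h3]) (by omega) (by simp [h1]) (by simp [h2]) (by simp [h3])
  have hu : AgreeUp ψ₁ φ r s := ⟨c1, c2, c3⟩
  have t := hu.agreeOn_top hψ₁ hφ.isFlat c0 hr hs
  have t' := hu.agreeOn_right hψ₁ hφ.isFlat c0 hr hs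
  have q1 : AgreeOn ψ₁ f r (r + 1) s (s + 1) := by
    intro i j g1 g2 g3 g4
    obtain rfl | rfl : i = r ∨ i = r + 1 := by omega
    all_goals obtain rfl | rfl : j = s ∨ j = s + 1 := by omega
    · exact c1.trans h1
    · exact c3.trans h3
    · exact c2.trans h2
    · exact c4
  obtain ⟨ψ₂, hψ₂, d1, d2⟩ := exists_chart_right hψ₁ hf (l := s) (a := r + 1) (b := s + 1) hs
    (by omega) (by omega) (q1.mono (by omega) le_rfl le_rfl le_rfl)
    (q1 _ _ (by omega) (by omega) (by omega) le_rfl)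
  have q2 : AgreeOn ψ₂ f r (r + 2) s (s + 1) := by
    intro i j g1 g2 g3 g4
    rcases le_or_gt i (r + 1) with hi | hi
    · exact (d1 i j (by omega) hi (by omega) g4).trans (q1 i j g1 hi g3 g4)
    · exact d2 i j (by omega) (by omega) g3 g4
  obtain ⟨ψ₃, hψ₃, e1, e2⟩ := exists_chart_top hψ₂ hf (k := r) (a := r + 2) (b := s + 1) hr
    (by omega) (by omega) (q2.mono le_rfl le_rfl (by omega) le_rfl)
    (q2 _ _ (by omega) le_rfl (by omega) (by omega))
  refine ⟨ψ₃, hψ₃, ?_, ?_, ?_⟩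
  · exact ((e1.mono le_rfl (by omega) le_rfl (by omega)).trans
      (d1.mono le_rfl (by omega) le_rfl (by omega))).trans t
  · exact ((e1.mono le_rfl (by omega) le_rfl (by omega)).trans
      (d1.mono le_rfl (by omega) le_rfl (by omega))).trans t'
  · intro i j g1 g2 g3 g4
    rcases le_or_gt j (s + 1) with hj | hj
    · exact (e1 i j (by omega) g2 (by omega) hj).trans (q2 i j g1 g2 g3 hj)
    · exact e2 i j g1 g2 (by omega) (by omega)

variable {Γ : Subgroup (Equiv.Perm V)}

/-- A rectangle of shape `(r, s)` in a flat contains a path of length `r + s`. -/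
theorem hasPath_letter {f : ℤ × ℤ ↪ V} (hf : B.IsFlat f) (r s : ℕ) :
    RankTwo.HasPath (B.M₁ Γ) (B.M₂ Γ) (r + s) (hf.letter Γ 0 0) (hf.letter Γ r s) := by
  -- The path makes its `r` horizontal steps first, then its `s` vertical ones.
  refine ⟨fun k => hf.letter Γ (min (k : ℕ) r : ℕ) ((k : ℕ) - min (k : ℕ) r : ℕ), by simp, by simp,
    fun k => ?_⟩
  rcases lt_or_ge (k : ℕ) r with hk | hk
  · left
    have h1 : min (k : ℕ) r = k := by omega
    have h2 : min ((k : ℕ) + 1) r = k + 1 := by omega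
    simpa [h1, h2] using M₁_letter (Γ := Γ) hf k 0
  · right
    have h1 : min (k : ℕ) r = r := by omega
    have h2 : min ((k : ℕ) + 1) r = r := by omega
    have h3 : (k : ℕ) + 1 - r = (k - r) + 1 := by omega
    simpa [h1, h2, h3] using M₂_letter (Γ := Γ) hf r ((k : ℕ) - r : ℕ)

theorem hasPath_four (hΓ : Γ ≤ B.typePreservingAut) (hreg : B.ActsRegularlyOnChambers Γ)
    (a b : B.Alphabet Γ) : RankTwo.HasPath (B.M₁ Γ) (B.M₂ Γ) 4 a b := by
  obtain ⟨f, hf, rfl⟩ := exists_chart_letter a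
  obtain ⟨g, hg, rfl⟩ := exists_chart_letter b
  -- The condition on `r, s` says that the initial tile lies in one of the two rectangles which
  -- `exists_chart_glue` preserves.
  have key : ∀ r s : ℕ, (2 ≤ r ∧ 1 ≤ s ∨ 1 ≤ r ∧ 2 ≤ s) →
      B.type (f ((r : ℤ), (s : ℤ))) = B.type (g (0, 0)) →
      RankTwo.HasPath (B.M₁ Γ) (B.M₂ Γ) (r + s) (hf.isFlat.letter Γ 0 0)
        (hg.isFlat.letter Γ 0 0) := by
    intro r s hrs ht
    obtain ⟨g', hg', h1, h2⟩ := exists_move_triangle hΓ hreg hf.isFlat hg.isFlat ht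
    obtain ⟨ψ, hψ, k1, k2, k3⟩ := exists_chart_glue hf hg' (by omega) (by omega) h1
    have e1 : hψ.isFlat.letter Γ 0 0 = hf.isFlat.letter Γ 0 0 := by
      refine hψ.isFlat.letter_congr _ ?_
      rcases hrs with hrs | hrs
      · exact k1.mono le_rfl (by omega) le_rfl (by omega)
      · exact k2.mono le_rfl (by omega) le_rfl (by omega)
    rw [← e1, ← h2, ← hψ.isFlat.letter_congr hg' k3]
    exact hasPath_letter hψ.isFlat r s
  have ht := hf.isFlat.2
  -- The points `(2, 2)`, `(3, 1)`, `(1, 3)` have relative types `0, 2, -2`, which exhaust `ℤ/3`.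
  have hc : B.type (g (0, 0)) - B.type (f (0, 0)) = 0 ∨
      B.type (g (0, 0)) - B.type (f (0, 0)) = 2 ∨ B.type (g (0, 0)) - B.type (f (0, 0)) = -2 := by
    generalize B.type (g (0, 0)) - B.type (f (0, 0)) = x
    decide +revert
  rcases hc with hc | hc | hc
  · refine key 2 2 (by omega) ?_
    rw [ht]
    push_cast
    linear_combination -hc
  · refine key 3 1 (by omega) ?_
    rw [ht]
    push_cast
    linear_combination -hc
  · refine key 1 3 (by omega) ?_
    rw [ht]
    push_cast
    linear_combination -hc

/-! ### Aperiodicity -/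

/-- In a thick building every edge of a flat lies on a chamber which is not in the flat. -/
theorem exists_third_chamber {q : ℕ} (hq : 2 ≤ q) (hB : B.HasOrder q) {f : ℤ × ℤ ↪ V}
    (hf : B.IsFlat f) (x : ℤ × ℤ) {u w : ℤ × ℤ} (h : IsFrame u w) :
    ∃ t ∈ B.complex, ∃ z ∈ t, f (x + u) ∈ t ∧ f (x + w) ∈ t ∧ z ≠ f x ∧ z ≠ f (x + u) ∧
      z ≠ f (x + w) ∧ z ≠ f (x + u + w) := by
  classical
  have he : Finset.map f {x + u, x + w} ∈ B.complex := hf.1 _ (pair_mem_plane (h.adj₃ x))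
  have hcard : (Finset.map f {x + u, x + w}).card = 2 := by
    rw [Finset.card_map, Finset.card_pair (h.adj₃ x).ne]
  have hn := hB _ he hcard
  set C := {c | c ∈ B.chambers ∧ Finset.map f {x + u, x + w} ⊆ c} with hC
  -- The flat supplies at most two of the `q + 1 ≥ 3` chambers on the edge.
  have h2 : ({Finset.map f {x, x + u, x + w}, Finset.map f {x + u + w, x + u, x + w}} :
      Set (Finset V)).ncard < C.ncard := by
    refine (Set.ncard_insert_le _ _).trans_lt ?_
    rw [Set.ncard_singleton, hn]
    omega
  obtain ⟨c, hc, hc'⟩ := Set.exists_mem_notMem_of_ncard_lt_ncard h2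
  obtain ⟨⟨hcc, hc3⟩, hec⟩ := hc
  obtain ⟨z, hz, hze⟩ : ∃ z ∈ c, z ∉ Finset.map f {x + u, x + w} := by
    by_contra hcon
    push Not at hcon
    have := Finset.card_le_card (show c ⊆ _ from hcon)
    omega
  have hceq : c = insert z (Finset.map f {x + u, x + w}) := by
    refine (Finset.eq_of_subset_of_card_le (Finset.insert_subset hz hec) ?_).symm
    rw [Finset.card_insert_of_notMem hze, hcard, hc3]
  refine ⟨c, hcc, z, hz, hec (by simp), hec (by simp), ?_, ?_, ?_, ?_⟩
  · rintro rfl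
    exact hc' (by simp [hceq])
  · rintro rfl
    simp at hze
  · rintro rfl
    simp at hze
  · rintro rfl
    exact hc' (by simp [hceq])

/-- The word of shape `(m, n)` of a flat. -/
def IsFlat.word {f : ℤ × ℤ ↪ V} (hf : B.IsFlat f) (m n : ℕ) :
    RankTwo.Word (B.M₁ Γ) (B.M₂ Γ) m n where
  letter i j := hf.letter Γ i j
  step₁ i j := by
    have := M₁_letter (Γ := Γ) hf i j
    simpa using this
  step₂ i j := by
    have := M₂_letter (Γ := Γ) hf i j
    simpa using this

/-- A third chamber on the antidiagonal edge of the last square changes its far corner; the hull of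
the origin and the near triangle survives. -/
theorem exists_chart_change_corner {q : ℕ} (hq : 2 ≤ q) (hB : B.HasOrder q) {f : ℤ × ℤ ↪ V}
    (hf : B.IsOrientedChart f) {a b : ℤ} (ha : 0 ≤ a) (hb : 0 ≤ b) :
    ∃ ψ : ℤ × ℤ ↪ V, B.IsOrientedChart ψ ∧ AgreeOn ψ f 0 a 0 (b + 1) ∧
      AgreeOn ψ f 0 (a + 1) 0 b ∧ ψ (a + 1, b + 1) ≠ f (a + 1, b + 1) := by
  obtain ⟨t, ht, z, hz, h1, h2, n0, n1, n2, n3⟩ :=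
    exists_third_chamber hq hB hf.isFlat (a, b) isFrame_std
  simp only [Prod.mk_add_mk, add_zero] at h1 h2 n1 n2 n3
  obtain ⟨ψ, hψ, c0, c1, c2, c3, rfl⟩ :=
    exists_extension_antidiag hf ht hz h1 h2 (by omega) n0 n1 n2
  have hu : AgreeUp ψ f a b := ⟨c1, c2, c3⟩
  exact ⟨ψ, hψ, hu.agreeOn_top hψ hf.isFlat c0 ha hb, hu.agreeOn_right hψ hf.isFlat c0 ha hb, n3⟩

/-- The analogue for a vertical edge on the right side of a rectangle, which is kept entirely. -/
theorem exists_chart_change_right {q : ℕ} (hq : 2 ≤ q) (hB : B.HasOrder q) {f : ℤ × ℤ ↪ V}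
    (hf : B.IsOrientedChart f) {a b : ℤ} (ha : 1 ≤ a) (hb : 0 ≤ b) :
    ∃ ψ : ℤ × ℤ ↪ V, B.IsOrientedChart ψ ∧ AgreeOn ψ f 0 a 0 (b + 1) ∧
      ψ (a + 1, b) ≠ f (a + 1, b) := by
  obtain ⟨t, ht, z, hz, h1, h2, n0, n1, n2, n3⟩ :=
    exists_third_chamber hq hB hf.isFlat (a - 1, b + 1) (u := (1, 0)) (w := (1, -1))
      (by simp [IsFrame])
  simp only [Prod.mk_add_mk, add_zero, sub_add_cancel, add_neg_cancel_right] at h1 h2 n1 n2 n3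
  obtain ⟨ψ, hψ, c0, c1, c2, c3, rfl⟩ :=
    exists_extension_right hf ht hz h2 h1 (by omega) n0 n2 n1
  refine ⟨ψ, hψ, ?_, n3⟩
  exact agreeOn_of_corner hψ hf.isFlat c0 ha (by omega) c3 c1 (by simpa using c2)

/-- The charts `f` and `ψ` part at the far corner of the tile at `(r, s)`, which the tile at the
origin avoids. Periodicity would transport the common letter from `(0, 0)` to `(r, s)`; as a chamber
there is common too, the tiles would coincide. -/
theorem exists_not_periodic_of_nonneg {q : ℕ} (hq : 2 ≤ q) (hB : B.HasOrder q)
    (hreg : B.ActsRegularlyOnChambers Γ) {f : ℤ × ℤ ↪ V} (hf : B.IsOrientedChart f) {r s : ℕ}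
    (hrs : 0 < r ∨ 0 < s) :
    ∃ (m n : ℕ) (w : RankTwo.Word (B.M₁ Γ) (B.M₂ Γ) m n), ¬ w.IsPeriodic ((r : ℤ), (s : ℤ)) := by
  obtain ⟨ψ, hψ, h1, h2, h3⟩ := exists_chart_change_corner hq hB hf (a := r + 1) (b := s + 1)
    (by omega) (by omega)
  by_contra! hcon
  have e1 := hcon r s (hf.isFlat.word r s) 0 (Fin.last r) 0 (Fin.last s) (by simp) (by simp)
  have e2 := hcon r s (hψ.isFlat.word r s) 0 (Fin.last r) 0 (Fin.last s) (by simp) (by simp)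
  have e3 : hψ.isFlat.letter Γ 0 0 = hf.isFlat.letter Γ 0 0 := by
    refine hψ.isFlat.letter_congr _ ?_
    rcases hrs with hrs | hrs
    · exact h1.mono le_rfl (by omega) le_rfl (by omega)
    · exact h2.mono le_rfl (by omega) le_rfl (by omega)
  have e4 : hψ.isFlat.letter Γ r s = hf.isFlat.letter Γ r s := by
    simp only [IsFlat.word, Fin.val_last, Fin.val_zero, Nat.cast_zero] at e1 e2
    rw [e1, e2, e3]
  have := agreeOn_of_letter_eq hreg hψ.isFlat hf.isFlat e4 (a := r + 1) (b := s + 1)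
    ⟨h1 _ _ (by omega) (by omega) (by omega) (by omega),
      h2 _ _ (by omega) (by omega) (by omega) (by omega),
      h1 _ _ (by omega) (by omega) (by omega) (by omega)⟩ (by omega) (by omega) (by omega)
    (by omega)
  exact h3 (this _ _ (by omega) (by omega) (by omega) (by omega))

/-- Here periodicity compares the letters at `(0, s)` and `(r, 0)`. The charts share the first, so
they would share the second and hence agree at `(r + 2, 0)`; convexity carries this up the column to
`(r + 2, s + 1)`, where they were chosen to differ. -/
theorem exists_not_periodic_of_neg {q : ℕ} (hq : 2 ≤ q) (hB : B.HasOrder q)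
    (hreg : B.ActsRegularlyOnChambers Γ) {f : ℤ × ℤ ↪ V} (hf : B.IsOrientedChart f) {r s : ℕ}
    (hr : 0 < r) (hs : 0 < s) :
    ∃ (m n : ℕ) (w : RankTwo.Word (B.M₁ Γ) (B.M₂ Γ) m n),
      ¬ w.IsPeriodic ((r : ℤ), -(s : ℤ)) := by
  obtain ⟨ψ, hψ, h1, h2⟩ := exists_chart_change_right hq hB hf (a := r + 1) (b := s + 1)
    (by omega) (by omega)
  by_contra! hcon
  have e1 := hcon r s (hf.isFlat.word r s) 0 (Fin.last r) (Fin.last s) 0 (by simp) (by simp)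
  have e2 := hcon r s (hψ.isFlat.word r s) 0 (Fin.last r) (Fin.last s) 0 (by simp) (by simp)
  have e3 : hψ.isFlat.letter Γ 0 s = hf.isFlat.letter Γ 0 s :=
    hψ.isFlat.letter_congr _ (h1.mono le_rfl (by omega) (by omega) (by omega))
  have e4 : hψ.isFlat.letter Γ r 0 = hf.isFlat.letter Γ r 0 := by
    simp only [IsFlat.word, Fin.val_last, Fin.val_zero, Nat.cast_zero] at e1 e2
    rw [e1, e2, e3]
  have h3 := agreeOn_of_letter_eq hreg hψ.isFlat hf.isFlat e4 (a := r) (b := 0)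
    (h1.agreeUp (by omega) (by omega) (by omega) (by omega)) (by omega) (by omega) (by omega)
    (by omega)
  -- The reference point `(r + 1, s + 2)` stays strictly above every antidiagonal edge crossed in
  -- this climb.
  have key : ∀ n : ℕ, n ≤ s + 1 → ψ (r + 1 + 1, n) = f (r + 1 + 1, n) := by
    intro n
    induction n with
    | zero => exact fun _ => h3 _ _ (by omega) (by omega) (by simp) (by simp)
    | succ n ih =>
      intro hn
      have := convex_antidiag' hψ hf.isFlat (i := r + 1) (j := n)
        (h1 (r + 1) (s + 1 + 1) (by omega) le_rfl (by omega) le_rfl) (ih (by omega))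
        (h1 _ _ (by omega) le_rfl (by omega) (by omega)) (by omega)
      exact_mod_cast this
  exact h2 (by exact_mod_cast key (s + 1) le_rfl)

/-! ### Finiteness -/

variable (B) in
/-- The vertices of the chambers which have an edge in `S`, together with `S`. -/
def neighbourhood (S : Set V) : Set V :=
  S ∪ {z | ∃ c ∈ B.chambers, z ∈ c ∧ ∃ x ∈ S, ∃ y ∈ S, x ≠ y ∧ x ∈ c ∧ y ∈ c}

theorem finite_neighbourhood {q : ℕ} (hB : B.HasOrder q) {S : Set V} (hS : S.Finite) :
    (B.neighbourhood S).Finite := by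
  classical
  refine hS.union ?_
  have : {z | ∃ c ∈ B.chambers, z ∈ c ∧ ∃ x ∈ S, ∃ y ∈ S, x ≠ y ∧ x ∈ c ∧ y ∈ c} ⊆
      ⋃ x ∈ S, ⋃ y ∈ S, ⋃ c ∈ {c | x ≠ y ∧ c ∈ B.chambers ∧ {x, y} ⊆ c}, (c : Set V) := by
    rintro z ⟨c, hc, hz, x, hx, y, hy, hxy, hxc, hyc⟩
    simp only [Set.mem_iUnion]
    exact ⟨x, hx, y, hy, c, ⟨hxy, hc, by simp [Finset.insert_subset_iff, hxc, hyc]⟩, hz⟩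
  refine Set.Finite.subset ?_ this
  refine hS.biUnion fun x _ => hS.biUnion fun y _ => Set.Finite.biUnion ?_ fun c _ =>
    c.finite_toSet
  by_cases h : x ≠ y ∧ {x, y} ∈ B.complex
  · refine (Set.finite_of_ncard_ne_zero
      (s := {c | c ∈ B.chambers ∧ ({x, y} : Finset V) ⊆ c}) ?_).subset fun _ hc => hc.2
    rw [hB _ h.2 (Finset.card_pair h.1)]
    omega
  · refine Set.finite_empty.subset ?_
    rintro c ⟨hxy, hc, hs⟩
    exact h ⟨hxy, (B.complex.isRelLowerSet_faces hc.1).2 hs (by simp)⟩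

theorem IsFlat.flip_mem_neighbourhood {f : ℤ × ℤ ↪ V} (hf : B.IsFlat f) {S : Set V} (x : ℤ × ℤ)
    {u w : ℤ × ℤ} (h : IsFrame u w) (h1 : f (x + u) ∈ S) (h2 : f (x + w) ∈ S) :
    f (x + u + w) ∈ B.neighbourhood S := by
  refine Or.inr ⟨Finset.map f {x + u, x + w, x + u + w}, ⟨hf.1 _ (h.far_mem x), ?_⟩, by simp,
    _, h1, _, h2, fun e => (h.adj₃ x).ne (f.injective e), by simp, by simp⟩
  rw [Finset.card_map, Finset.card_eq_three]
  exact ⟨_, _, _, (h.adj₃ x).ne, (h.adj₄ x).ne, (h.adj₅ x).ne, rfl⟩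

theorem subset_neighbourhood (S : Set V) : S ⊆ B.neighbourhood S := Set.subset_union_left

/-- Four rounds suffice: `(1,1)`, then `(2,0)` and `(0,2)`, then `(2,1)` and `(1,2)`, then `(2,2)`.
-/
theorem IsFlat.tile_subset {f : ℤ × ℤ ↪ V} (hf : B.IsFlat f) {S : Set V} (h0 : f (0, 0) ∈ S)
    (h1 : f (1, 0) ∈ S) (h2 : f (0, 1) ∈ S) {i j : ℤ} (hi : 0 ≤ i) (hi' : i ≤ 2) (hj : 0 ≤ j)
    (hj' : j ≤ 2) : f (i, j) ∈ (B.neighbourhood)^[4] S := by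
  have up : ∀ S i j, f (i + 1, j) ∈ S → f (i, j + 1) ∈ S →
      f (i + 1, j + 1) ∈ B.neighbourhood S := by
    intro S i j h1 h2
    have := hf.flip_mem_neighbourhood (S := S) (i, j) isFrame_std (by simpa using h1)
      (by simpa using h2)
    simpa using this
  have right : ∀ S i j, f (i, j) ∈ S → f (i, j + 1) ∈ S → f (i + 1, j) ∈ B.neighbourhood S := by
    intro S i j h1 h2
    have := hf.flip_mem_neighbourhood (S := S) (i - 1, j + 1) (u := (1, 0)) (w := (1, -1))
      (by simp [IsFrame]) (by simpa using h2) (by simpa using h1)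
    simpa using this
  have above : ∀ S i j, f (i, j) ∈ S → f (i + 1, j) ∈ S → f (i, j + 1) ∈ B.neighbourhood S := by
    intro S i j h1 h2
    have := hf.flip_mem_neighbourhood (S := S) (i + 1, j - 1) (u := (-1, 1)) (w := (0, 1))
      (by simp [IsFrame]) (by simpa using h1) (by simpa using h2)
    simpa using this
  have sub : ∀ S, S ⊆ B.neighbourhood S := subset_neighbourhood
  simp only [Function.iterate_succ, Function.iterate_zero, Function.comp_apply, id_eq]
  set S₁ := B.neighbourhood S
  set S₂ := B.neighbourhood S₁
  set S₃ := B.neighbourhood S₂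
  set S₄ := B.neighbourhood S₃
  have a11 : f (1, 1) ∈ S₁ := up S 0 0 h1 h2
  have a20 : f (2, 0) ∈ S₂ := right S₁ 1 0 (sub _ h1) a11
  have a02 : f (0, 2) ∈ S₂ := above S₁ 0 1 (sub _ h2) a11
  have a21 : f (2, 1) ∈ S₃ := up S₂ 1 0 a20 (sub _ a11)
  have a12 : f (1, 2) ∈ S₃ := up S₂ 0 1 (sub _ a11) a02
  have a22 : f (2, 2) ∈ S₄ := up S₃ 1 1 a21 a12
  interval_cases i <;> interval_cases j
  · exact sub _ (sub _ (sub _ (sub _ h0)))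
  · exact sub _ (sub _ (sub _ (sub _ h2)))
  · exact sub _ (sub _ a02)
  · exact sub _ (sub _ (sub _ (sub _ h1)))
  · exact sub _ (sub _ (sub _ a11))
  · exact sub _ a12
  · exact sub _ (sub _ a20)
  · exact sub _ a21
  · exact a22

theorem finite_alphabet {q : ℕ} (hB : B.HasOrder q) (hΓ : Γ ≤ B.typePreservingAut)
    (hreg : B.ActsRegularlyOnChambers Γ) {f₀ : ℤ × ℤ ↪ V} (hf₀ : B.IsFlat f₀) :
    Finite (B.Alphabet Γ) := by
  have hd := map_near_mem_chambers hf₀ (0, 0) isFrame_std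
  set T : Set V := (B.neighbourhood)^[4] (Finset.map f₀ {(0, 0), (0, 0) + (1, 0), (0, 0) + (0, 1)} :
    Finset V) with hT
  have hTfin : T.Finite := by
    simp only [hT, Function.iterate_succ, Function.iterate_zero, Function.comp_apply, id_eq]
    exact finite_neighbourhood hB (finite_neighbourhood hB (finite_neighbourhood hB
      (finite_neighbourhood hB (Finset.finite_toSet _))))
  have : Finite T := hTfin
  -- By transitivity each orbit has a tile whose initial chamber is the fixed one as a set; its nine
  -- vertices lie in the finite set `T` and determine the orbit.
  have key : ∀ a : B.Alphabet Γ, ∃ v : Fin 3 → Fin 3 → T, ∃ τ : B.Tile,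
      B.orbit Γ τ = a ∧ ∀ i j, τ.vertex i j = v i j := by
    intro a
    obtain ⟨g, hg, rfl⟩ := exists_chart_letter a
    have hc := map_near_mem_chambers hg.isFlat (0, 0) isFrame_std
    obtain ⟨γ, ⟨hγ, h1⟩, -⟩ := hreg _ hc _ hd
    obtain ⟨g', hg', e, e'⟩ := exists_translate hΓ hg.isFlat hγ 0 0 0 0
    have e0 := e' 0 0
    simp only [zero_add] at e e0
    have mem : ∀ r s, (r, s) ∈ ({(0, 0), (1, 0), (0, 1)} : Finset (ℤ × ℤ)) → g' (r, s) ∈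
        ((Finset.map f₀ {(0, 0), (0, 0) + (1, 0), (0, 0) + (0, 1)} : Finset V) : Set V) := by
      intro r s hrs
      rw [e, ← h1, Finset.mem_coe, ← Equiv.coe_toEmbedding, Finset.mem_map', Finset.mem_map']
      simpa using hrs
    have hmem : ∀ i j : Fin 3, g' ((i : ℤ), (j : ℤ)) ∈ T := fun i j =>
      hg'.tile_subset (mem 0 0 (by simp)) (mem 1 0 (by simp)) (mem 0 1 (by simp)) (by omega)
        (by omega) (by omega) (by omega)
    refine ⟨fun i j => ⟨_, hmem i j⟩, hg'.tile 0 0, e0, fun i j => ?_⟩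
    simp [IsFlat.tile, IsFlat.parallelogram]
  choose v τ hτ hv using key
  refine Finite.of_injective v fun a b hab => ?_
  rw [← hτ a, ← hτ b]
  exact congrArg _ (Parallelogram.ext_vertex fun i j => by rw [hv, hv, hab])

end TriangleBuilding

/-! ### Assembly of the conditions -/

theorem mainTheorem7 {V : Type*} (B : TriangleBuilding V) (q : ℕ) (hq : 2 ≤ q)
    (hB : B.HasOrder q) (Γ : Subgroup (Equiv.Perm V)) (hΓ : Γ ≤ B.typePreservingAut)
    (hreg : B.ActsRegularlyOnChambers Γ) :
    Finite (B.Alphabet Γ) ∧ B.M₁ Γ ≠ 0 ∧ B.M₂ Γ ≠ 0 ∧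
      RankTwo.H1 (B.M₁ Γ) (B.M₂ Γ) ∧
      (RankTwo.H2 (B.M₁ Γ) (B.M₂ Γ) ∧
        ∀ a b : B.Alphabet Γ, RankTwo.HasPath (B.M₁ Γ) (B.M₂ Γ) 4 a b) ∧
      RankTwo.H3 (B.M₁ Γ) (B.M₂ Γ) := by
  obtain ⟨f, hf⟩ : ∃ f : ℤ × ℤ ↪ V, B.IsOrientedChart f := by
    obtain ⟨v⟩ := B.nonempty
    have hv : {v} ∈ B.complex := B.complex.singleton_mem v
    obtain ⟨S, hS, -⟩ := B.exists_apartment _ hv _ hv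
    obtain ⟨f, -, hf⟩ := TriangleBuilding.exists_orientedChart hS
    exact ⟨f, hf⟩
  have path := TriangleBuilding.hasPath_four hΓ hreg
  refine ⟨TriangleBuilding.finite_alphabet hB hΓ hreg hf.isFlat, fun h => ?_, fun h => ?_,
    RankTwo.h1_of_squares
      (fun a b c hab hbc => TriangleBuilding.existsUnique_square₂ hΓ hreg hab hbc)
      (fun a b c hab hbc => TriangleBuilding.existsUnique_square₁ hΓ hreg hab hbc),
    ⟨fun a b => ⟨4, by omega, path a b⟩, path⟩, ?_⟩
  · have := TriangleBuilding.M₁_letter (Γ := Γ) hf.isFlat 0 0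
    simp [h] at this
  · have := TriangleBuilding.M₂_letter (Γ := Γ) hf.isFlat 0 0
    simp [h] at this
  -- Periodicity under `p` and under `-p` are equivalent, so half of the nonzero vectors suffice.
  · have key : ∀ p : ℤ × ℤ, p ≠ 0 → 0 ≤ p.1 → (p.1 = 0 → 0 ≤ p.2) → ∃ (m n : ℕ)
        (w : RankTwo.Word (B.M₁ Γ) (B.M₂ Γ) m n), ¬ w.IsPeriodic p := by
      rintro ⟨p1, p2⟩ hp h1 h2
      simp only at h1 h2
      lift p1 to ℕ using h1
      rcases le_or_gt 0 p2 with h | h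
      · lift p2 to ℕ using h
        refine TriangleBuilding.exists_not_periodic_of_nonneg hq hB hreg hf ?_
        by_contra hcon
        apply hp
        ext <;> simp <;> omega
      · obtain ⟨s, rfl⟩ : ∃ s : ℕ, p2 = -(s : ℤ) := ⟨p2.natAbs, by omega⟩
        exact TriangleBuilding.exists_not_periodic_of_neg hq hB hreg hf (by omega) (by omega)
    intro p hp
    by_cases hpos : 0 ≤ p.1 ∧ (p.1 = 0 → 0 ≤ p.2)
    · exact key p hp hpos.1 hpos.2
    · obtain ⟨m, n, w, hw⟩ := key (-p) (neg_ne_zero.2 hp) (by rw [Prod.fst_neg]; omega)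
        (by rw [Prod.fst_neg, Prod.snd_neg]; omega)
      exact ⟨m, n, w, fun h => hw h.neg⟩
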